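/- Throughout, $\Omega=\{x\ge 1,\ Y>0\}$, $0<\delta<1$, $0\le\sigma<1$, and for $n\ge 2$ and $1\le i\le n$ put $\sigma_i=\frac{3^i}{1000\cdot 3^n}$. A quantity $\mathcal O(\delta,\sigma)$ is a function of $(\delta,\sigma)$ that tends to $0$ as $(\delta,\sigma)\to(0,0)$, $\delta>0$, $\sigma\ge0$. Put $a_1=\frac12$ and $a_i=\frac34-\sigma_{i-1}$ for $2\le i\le n$. Let $(v_p^{i-1},g_p^{i-1})(x,y)$ be the normal components of the boundary layer profile of order $i-1$. The corrector of order $i$ sees this profile only through its wall values. Assume that $f_i(x)=-v_p^{i-1}(x,0)$ is smooth on $[1,\infty)$ with $|f_i^{(k)}(x)|\le B_kx^{-k-a_i}$ for all $k\ge0$, and for $i=1$ also $|f_1(x)|\le\mathcal O(\delta,\sigma)x^{-1/2}$. (a) The function $f_i$ has a smooth extension $F$ to $\mathbb R$ with $|F^{(k)}(x)|\le A_k(1+|x|)^{-k-a_i}$ for all $k\ge0$, and for $i=1$ also $|F(x)|\le\mathcal O(\delta,\sigma)(1+|x|)^{-1/2}$. Here the $A_k$ depend only on $(B_k)_k$ if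 $i=1$, and only on $(B_k)_k$ and $n$ if $i\ge2$. For $i=1$ the quantity $\mathcal O(\delta,\sigma)$ for $F$ depends only on $(B_k)_k$ and on the one for $f_1$. (b) For every such extension $F$, let $v_e^i$ be its Poisson extension, $$v_e^i(x,Y)=\frac1\pi\int_{\mathbb R}\frac{Y}{(x-t)^2+Y^2}F(t)\,dt\quad(Y>0),\qquad v_e^i(x,0)=F(x),$$ and put $u_e^i(x,Y)=\int_x^\infty\partial_Yv_e^i(\theta,Y)\,d\theta$, $(h_e^i,g_e^i)=\sigma(u_e^i,v_e^i)$, $p_e^i=-(1-\sigma^2)u_e^i$. Then $v_e^i$ is harmonic for $Y>0$, continuous up to the wall with $v_e^i(x,0)=-v_p^{i-1}(x,0)$ for $x\ge1$, and tends to $0$ as $Y\to\infty$; the integral for $u_e^i$ converges absolutely; all fields are smooth in $\{Y>0\}$, and in $\Omega$ $$\begin{aligned}&\partial_xu_e^i-\sigma\partial_xh_e^i+\partial_xp_e^i=0,\qquad \partial_xv_e^i-\sigma\partial_xg_e^i+\partial_Yp_e^i=0,\\ &\partial_xh_e^i-\sigma\partial_xu_e^i=0,\qquad \partial_xg_e^i-\sigma\partial_xv_e^i=0,\\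 &\partial_xu_e^i+\partial_Yv_e^i=\partial_xh_e^i+\partial_Yg_e^i=0,\qquad (v_e^i,g_e^i)\to(0,0)\ \text{ as } Y\to\infty.\end{aligned}$$ Moreover $g_e^i$ is continuous up to the wall, and $(v_e^i,g_e^i)(x,0)=-(v_p^{i-1},g_p^{i-1})(x,0)$ for $x\ge1$ whenever the wall values satisfy $g_p^{i-1}(x,0)=\sigma v_p^{i-1}(x,0)$ for all $x\ge1$. (c) For all $x\ge1$ and $k,j\ge0$, $$\|\partial_x^k\partial_Y^j(u_e^i,v_e^i,h_e^i,g_e^i)\|_{L^\infty_Y}\le C(k,j)\,x^{-k-j-a_i},$$ for all $x\ge1$ and $k\ge1$, $$\|Y\,\partial_x^k(v_e^i,g_e^i)\|_{L^\infty_Y}\le C(k)\,x^{-k+1-a_i},$$ and for $i=1$ and all $x\ge1$ also $$\|(u_e^1,v_e^1,h_e^1,g_e^1)\|_{L^\infty_Y}\le\mathcal O(\delta,\sigma)x^{-\frac12},\qquad \|(\partial_xu_e^1,\partial_Yv_e^1,\partial_xh_e^1,\partial_Yg_e^1)\|_{L^\infty_Y}\le\mathcal O(\delta,\sigma)x^{-\frac32}.$$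 The constants depend on $k,j$, on $(A_k)_k$ and, for $i\ge2$, on $n$, but not on $\delta$, $\sigma$, $i$ or the profile. The last $\mathcal O(\delta,\sigma)$ depends only on $(A_k)_k$ and on the $\mathcal O(\delta,\sigma)$ bounding $F$. -/

import Mathlib

open Set Filter Topology MeasureTheory
open scoped ContDiff

noncomputable section

namespace IdealMHD

/-- The partial derivative in the tangential variable `x`. -/
def dx (f : ℝ → ℝ → ℝ) (x Y : ℝ) : ℝ := deriv (fun s => f s Y) x

/-- The partial derivative in the normal variable `Y`. -/
def dY (f : ℝ → ℝ → ℝ) (x Y : ℝ) : ℝ := deriv (fun s => f x s) Y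

/-- The mixed partial derivative `∂_x^k ∂_Y^j f`. -/
def mixed (k j : ℕ) (f : ℝ → ℝ → ℝ) : ℝ → ℝ → ℝ := dx^[k] (dY^[j] f)

/-- The open upper half plane `{Y > 0}`. -/
def upper : Set (ℝ × ℝ) := {q | 0 < q.2}

/-- A quantity of type `𝒪(δ, σ)`: it becomes small when `δ > 0` and `σ ≥ 0` are small. -/
def IsO (m : ℝ → ℝ → ℝ) : Prop :=
  Tendsto (fun q : ℝ × ℝ => m q.1 q.2) (𝓝[Ioi 0 ×ˢ Ici 0] ((0 : ℝ), (0 : ℝ))) (𝓝 0)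

/-- The loss exponents `σ_i = 3^i / (3^n * 1000)`. -/
def lossExp (n i : ℕ) : ℝ := (3 : ℝ) ^ i / ((3 : ℝ) ^ n * 1000)

/-- `f` is smooth on `[1, ∞)`, up to the end point, and `|f⁽ᵏ⁾(x)| ≤ B_k x^{-k-a}` there. -/
def WallDecay (a : ℝ) (B : ℕ → ℝ) (f : ℝ → ℝ) : Prop :=
  ContDiffOn ℝ ∞ f (Ici 1) ∧
    ∀ (k : ℕ) (x : ℝ), 1 ≤ x →
      |iteratedDerivWithin k f (Ici 1) x| ≤ B k * x ^ (-(k : ℝ) - a)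

/-- `F` extends `f` from `[1, ∞)` smoothly to the whole line, with
`|F⁽ᵏ⁾(x)| ≤ A_k (1 + |x|)^{-k-a}` on `ℝ`. -/
def IsWallExtension (a : ℝ) (A : ℕ → ℝ) (f F : ℝ → ℝ) : Prop :=
  (∀ x, 1 ≤ x → F x = f x) ∧ ContDiff ℝ ∞ F ∧
    ∀ (k : ℕ) (x : ℝ), |iteratedDeriv k F x| ≤ A k * (1 + |x|) ^ (-(k : ℝ) - a)

/-- The Poisson (harmonic) extension of `F` to the closed upper half plane. -/
def poisson (F : ℝ → ℝ) (x Y : ℝ) : ℝ :=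
  if 0 < Y then Real.pi⁻¹ * ∫ t, Y / ((x - t) ^ 2 + Y ^ 2) * F t else F x

/-- Velocity `(u, v)`, magnetic field `(h, g)` and pressure `p`. -/
structure Fields where
  u : ℝ → ℝ → ℝ
  v : ℝ → ℝ → ℝ
  h : ℝ → ℝ → ℝ
  g : ℝ → ℝ → ℝ
  p : ℝ → ℝ → ℝ

/-- `u(x, Y) = ∫_x^∞ ∂_Y v(θ, Y) dθ`. -/
def tangential (v : ℝ → ℝ → ℝ) (x Y : ℝ) : ℝ := ∫ θ in Ioi x, dY v θ Y

/-- The ideal MHD corrector generated by the wall datum `F`. -/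
def corrector (σ : ℝ) (F : ℝ → ℝ) : Fields where
  u := tangential (poisson F)
  v := poisson F
  h := fun x Y => σ * tangential (poisson F) x Y
  g := fun x Y => σ * poisson F x Y
  p := fun x Y => -(1 - σ ^ 2) * tangential (poisson F) x Y

/-- The boundary value problem for `(u, v)` on `{x ≥ 1, Y > 0}`: `v` is harmonic, continuous up to
the wall with `v(x, 0) = -v_p(x, 0)`, vanishes as `Y → ∞`, and `u = ∫_x^∞ v_Y` with an absolutely
convergent integral. -/
structure SolvesHarmonic (vp u v : ℝ → ℝ → ℝ) : Prop where
  smooth : ContDiffOn ℝ ∞ (fun q : ℝ × ℝ => v q.1 q.2) upper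
  harmonic : ∀ x Y : ℝ, 1 ≤ x → 0 < Y → dx (dx v) x Y + dY (dY v) x Y = 0
  continuous : ContinuousOn (fun q : ℝ × ℝ => v q.1 q.2) (Ici 1 ×ˢ Ici 0)
  wall : ∀ x : ℝ, 1 ≤ x → v x 0 = -vp x 0
  far : ∀ x : ℝ, 1 ≤ x → Tendsto (fun Y => v x Y) atTop (𝓝 0)
  integrable : ∀ x Y : ℝ, 1 ≤ x → 0 < Y → IntegrableOn (fun θ => dY v θ Y) (Ioi x)
  tangential : ∀ x Y : ℝ, 1 ≤ x → 0 < Y → u x Y = ∫ θ in Ioi x, dY v θ Y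

/-- The ideal MHD equations linearized about `(1, 0, σ, 0)`, on `{x ≥ 1, Y > 0}`, with wall data
`-(v_p, g_p)(x, 0)` for `(v, g)` and with `(v, g) → 0` as `Y → ∞`. -/
structure SolvesLinearizedMHD (σ : ℝ) (vp gp : ℝ → ℝ → ℝ) (e : Fields) : Prop where
  smooth_u : ContDiffOn ℝ ∞ (fun q : ℝ × ℝ => e.u q.1 q.2) upper
  smooth_v : ContDiffOn ℝ ∞ (fun q : ℝ × ℝ => e.v q.1 q.2) upper
  smooth_h : ContDiffOn ℝ ∞ (fun q : ℝ × ℝ => e.h q.1 q.2) upper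
  smooth_g : ContDiffOn ℝ ∞ (fun q : ℝ × ℝ => e.g q.1 q.2) upper
  smooth_p : ContDiffOn ℝ ∞ (fun q : ℝ × ℝ => e.p q.1 q.2) upper
  momentum_x : ∀ x Y : ℝ, 1 ≤ x → 0 < Y →
    dx e.u x Y - σ * dx e.h x Y + dx e.p x Y = 0
  momentum_Y : ∀ x Y : ℝ, 1 ≤ x → 0 < Y →
    dx e.v x Y - σ * dx e.g x Y + dY e.p x Y = 0
  induction_x : ∀ x Y : ℝ, 1 ≤ x → 0 < Y → dx e.h x Y - σ * dx e.u x Y = 0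
  induction_Y : ∀ x Y : ℝ, 1 ≤ x → 0 < Y → dx e.g x Y - σ * dx e.v x Y = 0
  div_velocity : ∀ x Y : ℝ, 1 ≤ x → 0 < Y → dx e.u x Y + dY e.v x Y = 0
  div_magnetic : ∀ x Y : ℝ, 1 ≤ x → 0 < Y → dx e.h x Y + dY e.g x Y = 0
  continuous_v : ContinuousOn (fun q : ℝ × ℝ => e.v q.1 q.2) (Ici 1 ×ˢ Ici 0)
  continuous_g : ContinuousOn (fun q : ℝ × ℝ => e.g q.1 q.2) (Ici 1 ×ˢ Ici 0)
  wall_v : ∀ x : ℝ, 1 ≤ x → e.v x 0 = -vp x 0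
  wall_g : ∀ x : ℝ, 1 ≤ x → e.g x 0 = -gp x 0
  far_v : ∀ x : ℝ, 1 ≤ x → Tendsto (fun Y => e.v x Y) atTop (𝓝 0)
  far_g : ∀ x : ℝ, 1 ≤ x → Tendsto (fun Y => e.g x Y) atTop (𝓝 0)

/-- The construction succeeds for the wall profile `v_p`: `(u, v)` solves its boundary value problem,
and all fields together solve the linearized system, for every `g_p` that has the wall value
`σ v_p` (for another wall value the system has no solution with `g = σ v`). -/
def Solves (σ : ℝ) (vp : ℝ → ℝ → ℝ) (e : Fields) : Prop :=
  SolvesHarmonic vp e.u e.v ∧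
    ∀ gp : ℝ → ℝ → ℝ, (∀ x : ℝ, 1 ≤ x → gp x 0 = σ * vp x 0) → SolvesLinearizedMHD σ vp gp e

/-- `‖∂_x^k ∂_Y^j (u, v, h, g)‖_{L^∞_Y} ≤ K_{kj} x^{-k-j-a}` for all `k, j ≥ 0`, and
`‖Y ∂_x^k (v, g)‖_{L^∞_Y} ≤ K_{k0} x^{-k+1-a}` for all `k ≥ 1`. -/
structure DecayBounds (a : ℝ) (K : ℕ → ℕ → ℝ) (e : Fields) : Prop where
  derivatives : ∀ (k j : ℕ) (x Y : ℝ), 1 ≤ x → 0 < Y →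
    |mixed k j e.u x Y| ≤ K k j * x ^ (-(k : ℝ) - j - a) ∧
    |mixed k j e.v x Y| ≤ K k j * x ^ (-(k : ℝ) - j - a) ∧
    |mixed k j e.h x Y| ≤ K k j * x ^ (-(k : ℝ) - j - a) ∧
    |mixed k j e.g x Y| ≤ K k j * x ^ (-(k : ℝ) - j - a)
  weighted : ∀ (k : ℕ) (x Y : ℝ), 1 ≤ k → 1 ≤ x → 0 < Y →
    Y * |mixed k 0 e.v x Y| ≤ K k 0 * x ^ (-(k : ℝ) + 1 - a) ∧
    Y * |mixed k 0 e.g x Y| ≤ K k 0 * x ^ (-(k : ℝ) + 1 - a)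

/-- `‖(u, v, h, g)‖_{L^∞_Y} ≤ η x^{-1/2}` and
`‖(u_x, v_Y, h_x, g_Y)‖_{L^∞_Y} ≤ η x^{-3/2}`. -/
structure SmallBounds (η : ℝ) (e : Fields) : Prop where
  zeroth : ∀ x Y : ℝ, 1 ≤ x → 0 < Y →
    |e.u x Y| ≤ η * x ^ (-(1 / 2) : ℝ) ∧ |e.v x Y| ≤ η * x ^ (-(1 / 2) : ℝ) ∧
    |e.h x Y| ≤ η * x ^ (-(1 / 2) : ℝ) ∧ |e.g x Y| ≤ η * x ^ (-(1 / 2) : ℝ)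
  first : ∀ x Y : ℝ, 1 ≤ x → 0 < Y →
    |dx e.u x Y| ≤ η * x ^ (-(3 / 2) : ℝ) ∧ |dY e.v x Y| ≤ η * x ^ (-(3 / 2) : ℝ) ∧
    |dx e.h x Y| ≤ η * x ^ (-(3 / 2) : ℝ) ∧ |dY e.g x Y| ≤ η * x ^ (-(3 / 2) : ℝ)

end IdealMHD

end

namespace IdealMHD

/-- The Cauchy transform of a real density on the line. -/
noncomputable def cauchy (G : ℝ → ℝ) (z : ℂ) : ℂ := ∫ t : ℝ, (G t : ℂ) / (z - t)

/-- `G` is continuously differentiable with derivative `G'`, and both decay algebraically. -/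
structure C1Decay (a M N : ℝ) (G G' : ℝ → ℝ) : Prop where
  hasDerivAt : ∀ t, HasDerivAt G (G' t) t
  continuous_deriv : Continuous G'
  bound : ∀ t, |G t| ≤ M * (1 + |t|) ^ (-a)
  bound_deriv : ∀ t, |G' t| ≤ N * (1 + |t|) ^ (-1 - a)

theorem C1Decay.continuous {a M N : ℝ} {G G' : ℝ → ℝ} (h : C1Decay a M N G G') : Continuous G :=
  continuous_iff_continuousAt.2 fun t => (h.hasDerivAt t).continuousAt

theorem integrable_one_add_abs_rpow {a : ℝ} (ha : 0 < a) :
    Integrable fun t : ℝ => (1 + |t|) ^ (-1 - a) := by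
  have := integrable_one_add_norm (E := ℝ) (μ := volume) (r := 1 + a) (by simp; linarith)
  convert this using 2
  rw [Real.norm_eq_abs]; congr 1; ring

theorem sub_ofReal_ne_zero {z : ℂ} (hz : 0 < z.im) (t : ℝ) : z - t ≠ 0 := by
  intro h
  have := congrArg Complex.im h
  simp at this
  linarith

theorem hasDerivAt_sub_ofReal (z : ℂ) (t : ℝ) : HasDerivAt (fun t : ℝ => z - (t : ℂ)) (-1) t := by
  simpa using (Complex.ofRealCLM.hasDerivAt (x := t)).const_sub z

theorem im_le_norm_sub_ofReal (z : ℂ) (t : ℝ) : z.im ≤ ‖z - t‖ := by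
  have := Complex.abs_im_le_norm (z - t)
  simp at this
  exact (le_abs_self _).trans this

theorem one_add_abs_le_mul_norm_sub {y R : ℝ} (hy : 0 < y) {z : ℂ} (hz : y ≤ z.im) (hR : ‖z‖ ≤ R)
    (t : ℝ) : 1 + |t| ≤ (1 + (1 + R) / y) * ‖z - t‖ := by
  have h1 : y ≤ ‖z - t‖ := hz.trans (im_le_norm_sub_ofReal z t)
  have h2 : |t| ≤ ‖z - t‖ + R := by
    have : ‖(t : ℂ)‖ ≤ ‖z - t‖ + ‖z‖ := by
      have := norm_sub_le z (z - t)
      rw [sub_sub_cancel] at this; linarith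
    rw [Complex.norm_real, Real.norm_eq_abs] at this; linarith
  have hR0 : 0 ≤ R := (norm_nonneg _).trans hR
  have h3 : 1 + R ≤ (1 + R) / y * ‖z - t‖ := by
    rw [div_mul_eq_mul_div, le_div_iff₀ hy]
    exact mul_le_mul_of_nonneg_left h1 (by linarith)
  linarith

theorem one_add_abs_rpow_neg (a t : ℝ) :
    (1 + |t|) ^ (-a) = (1 + |t|) * (1 + |t|) ^ (-1 - a) := by
  have h0 : 0 < 1 + |t| := by positivity
  rw [mul_comm, ← Real.rpow_add_one h0.ne']
  congr 1; ring

theorem norm_div_sub_le {a M y R : ℝ} {g : ℝ} {t : ℝ} (hg : |g| ≤ M * (1 + |t|) ^ (-a))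
    (hy : 0 < y) {z : ℂ} (hz : y ≤ z.im) (hR : ‖z‖ ≤ R) :
    ‖(g : ℂ) / (z - t)‖ ≤ M * (1 + (1 + R) / y) * (1 + |t|) ^ (-1 - a) := by
  have h0 : 0 < 1 + |t| := by positivity
  have hM : 0 ≤ M := by
    have h1 : 0 < (1 + |t|) ^ (-a) := Real.rpow_pos_of_pos h0 _
    by_contra! h
    nlinarith [abs_nonneg g]
  have hn : 0 < ‖z - t‖ := hy.trans_le (hz.trans (im_le_norm_sub_ofReal z t))
  have h1 := one_add_abs_le_mul_norm_sub hy hz hR t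
  rw [norm_div, Complex.norm_real, Real.norm_eq_abs, div_le_iff₀ hn]
  rw [one_add_abs_rpow_neg] at hg
  refine hg.trans ?_
  have h2 : 0 ≤ (1 + |t|) ^ (-1 - a) := Real.rpow_nonneg h0.le _
  calc M * ((1 + |t|) * (1 + |t|) ^ (-1 - a))
      = (1 + |t|) * (M * (1 + |t|) ^ (-1 - a)) := by ring
    _ ≤ ((1 + (1 + R) / y) * ‖z - t‖) * (M * (1 + |t|) ^ (-1 - a)) :=
        mul_le_mul_of_nonneg_right h1 (mul_nonneg hM h2)
    _ = _ := by ring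

theorem integrable_div_sub {a M : ℝ} (ha : 0 < a) {G : ℝ → ℝ} (hG : Continuous G)
    (hb : ∀ t, |G t| ≤ M * (1 + |t|) ^ (-a)) {z : ℂ} (hz : 0 < z.im) :
    Integrable fun t : ℝ => (G t : ℂ) / (z - t) := by
  refine Integrable.mono' ((integrable_one_add_abs_rpow ha).const_mul
    (M * (1 + (1 + ‖z‖) / z.im))) ?_ (Eventually.of_forall fun t => ?_)
  · have : Continuous fun t : ℝ => (G t : ℂ) / (z - t) :=
      Continuous.div (by fun_prop) (by fun_prop) (sub_ofReal_ne_zero hz)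
    exact this.aestronglyMeasurable
  · exact norm_div_sub_le (hb t) hz le_rfl le_rfl

theorem tendsto_div_sub_zero {a M : ℝ} (ha : 0 < a) {G : ℝ → ℝ}
    (hb : ∀ t, |G t| ≤ M * (1 + |t|) ^ (-a)) {z : ℂ} (hz : 0 < z.im) {l : Filter ℝ}
    (hl : Tendsto (fun t : ℝ => |t|) l atTop) :
    Tendsto (fun t : ℝ => (G t : ℂ) / (z - t)) l (𝓝 0) := by
  have h1 : Tendsto (fun t : ℝ => (1 + |t|) ^ (-1 - a)) l (𝓝 0) := by
    have := (tendsto_rpow_neg_atTop (y := 1 + a) (by linarith)).comp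
      (tendsto_atTop_add_const_left l 1 hl)
    refine this.congr fun t => ?_
    simp only [Function.comp]
    congr 1; ring
  refine squeeze_zero_norm (fun t => norm_div_sub_le (hb t) hz le_rfl le_rfl) ?_
  simpa using h1.const_mul (M * (1 + (1 + ‖z‖) / z.im))

theorem hasDerivAt_cauchy_neg_integral {a M : ℝ} (ha : 0 < a) {G : ℝ → ℝ} (hG : Continuous G)
    (hb : ∀ t, |G t| ≤ M * (1 + |t|) ^ (-a)) {z : ℂ} (hz : 0 < z.im) :
    Integrable (fun t : ℝ => -((G t : ℂ) / (z - t) ^ 2)) ∧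
      HasDerivAt (cauchy G) (∫ t : ℝ, -((G t : ℂ) / (z - t) ^ 2)) z := by
  have hball : ∀ w ∈ Metric.ball z (z.im / 2), z.im / 2 ≤ w.im ∧ ‖w‖ ≤ ‖z‖ + z.im := by
    intro w hw
    rw [mem_ball_iff_norm] at hw
    have h1 := (abs_lt.1 ((Complex.abs_im_le_norm (w - z)).trans_lt hw)).1
    have h2 := norm_add_le z (w - z)
    rw [add_sub_cancel] at h2
    simp at h1
    constructor <;> linarith
  have hy : 0 < z.im / 2 := by linarith
  set c := 1 + (1 + (‖z‖ + z.im)) / (z.im / 2) with hc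
  have key := hasDerivAt_integral_of_dominated_loc_of_deriv_le (μ := (volume : Measure ℝ))
    (F := fun w t => (G t : ℂ) / (w - (t : ℂ))) (x₀ := z)
    (F' := fun w t => -((G t : ℂ) / (w - (t : ℂ)) ^ 2))
    (bound := fun t => (M * c * (1 + |t|) ^ (-1 - a)) * (z.im / 2)⁻¹)
    (Metric.ball_mem_nhds z hy) ?_ (integrable_div_sub ha hG hb hz) ?_ ?_ ?_ ?_
  · exact key
  · filter_upwards [Metric.ball_mem_nhds z hy] with w hw
    exact (integrable_div_sub ha hG hb (hy.trans_le (hball w hw).1)).aestronglyMeasurable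
  · have : Continuous fun t : ℝ => -((G t : ℂ) / (z - t) ^ 2) :=
      (Continuous.div (by fun_prop) (by fun_prop)
        fun t => pow_ne_zero 2 (sub_ofReal_ne_zero hz t)).neg
    exact this.aestronglyMeasurable
  · refine Eventually.of_forall fun t w hw => ?_
    obtain ⟨h1, h2⟩ := hball w hw
    have h3 := norm_div_sub_le (hb t) hy h1 h2
    have h4 : z.im / 2 ≤ ‖w - t‖ := h1.trans (im_le_norm_sub_ofReal w t)
    rw [norm_neg, pow_two, ← div_div, norm_div _ (w - (t : ℂ)), div_eq_mul_inv]
    refine mul_le_mul h3 (inv_anti₀ hy h4) (by positivity) ((norm_nonneg _).trans h3)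
  · exact ((integrable_one_add_abs_rpow ha).const_mul _).mul_const _
  · refine Eventually.of_forall fun t w hw => ?_
    have hne := sub_ofReal_ne_zero (hy.trans_le (hball w hw).1) t
    have := ((hasDerivAt_const w (G t : ℂ)).fun_div ((hasDerivAt_id' w).sub_const (t : ℂ)) hne)
    refine this.congr_deriv ?_
    simp [neg_div]

theorem C1Decay.bound_deriv' {a M N : ℝ} {G G' : ℝ → ℝ} (h : C1Decay a M N G G') (t : ℝ) :
    |G' t| ≤ N * (1 + |t|) ^ (-(1 + a)) := by
  have := h.bound_deriv t
  rwa [show -1 - a = -(1 + a) by ring] at this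

theorem C1Decay.hasDerivAt_cauchy {a M N : ℝ} (ha : 0 < a) {G G' : ℝ → ℝ}
    (h : C1Decay a M N G G') {z : ℂ} (hz : 0 < z.im) :
    HasDerivAt (cauchy G) (cauchy G' z) z := by
  obtain ⟨hi, hd⟩ := hasDerivAt_cauchy_neg_integral ha h.continuous h.bound hz
  have hi' := integrable_div_sub (by linarith) h.continuous_deriv h.bound_deriv' hz
  have hparts : ∀ t : ℝ, HasDerivAt (fun t : ℝ => (G t : ℂ) / (z - t))
      ((G' t : ℂ) / (z - t) - -((G t : ℂ) / (z - t) ^ 2)) t := by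
    intro t
    have hne := sub_ofReal_ne_zero hz t
    refine ((h.hasDerivAt t).ofReal_comp.fun_div (hasDerivAt_sub_ofReal z t) hne).congr_deriv ?_
    field_simp
  have h0 := integral_of_hasDerivAt_of_tendsto hparts (hi'.sub hi)
    (tendsto_div_sub_zero ha h.bound hz tendsto_abs_atBot_atTop)
    (tendsto_div_sub_zero ha h.bound hz tendsto_abs_atTop_atTop)
  rw [integral_sub hi' hi, sub_zero, sub_eq_zero] at h0
  unfold cauchy at *
  rwa [h0]

theorem C1Decay.mul_cauchy_deriv {a M N : ℝ} (ha : 0 < a) {G G' : ℝ → ℝ}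
    (h : C1Decay a M N G G') {z : ℂ} (hz : 0 < z.im) :
    z * cauchy G' z = cauchy (fun t => t * G' t) z := by
  have hi : Integrable G' := by
    refine Integrable.mono' ((integrable_one_add_abs_rpow ha).const_mul N)
      h.continuous_deriv.aestronglyMeasurable (Eventually.of_forall fun t => ?_)
    exact h.bound_deriv t
  have hlim : ∀ l : Filter ℝ, Tendsto (fun t : ℝ => |t|) l atTop → Tendsto G l (𝓝 0) := by
    intro l hl
    refine squeeze_zero_norm h.bound ?_
    simpa using ((tendsto_rpow_neg_atTop ha).comp
      (tendsto_atTop_add_const_left l 1 hl)).const_mul M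
  have h0 : ∫ t, G' t = 0 := by
    rw [integral_of_hasDerivAt_of_tendsto h.hasDerivAt hi (hlim _ tendsto_abs_atBot_atTop)
      (hlim _ tendsto_abs_atTop_atTop), sub_zero]
  have hi' := integrable_div_sub (by linarith) h.continuous_deriv h.bound_deriv' hz
  have e : ∀ t : ℝ, ((t * G' t : ℝ) : ℂ) / (z - t) = z * ((G' t : ℂ) / (z - t)) - (G' t : ℂ) := by
    intro t
    have hne := sub_ofReal_ne_zero hz t
    push_cast
    field_simp
    ring
  unfold cauchy
  simp_rw [e]
  have h1 := integral_sub (hi'.const_mul z) (hi.ofReal (𝕜 := ℂ))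
  rw [integral_const_mul, integral_ofReal, h0] at h1
  simpa using h1.symm

theorem norm_integral_inv_sub_le {z : ℂ} (hz : 0 < z.im) (r : ℝ) :
    ‖∫ t in (z.re - r)..(z.re + r), 1 / (z - (t : ℂ))‖ ≤ 2 * Real.pi := by
  have hd : ∀ t ∈ uIcc (z.re - r) (z.re + r),
      HasDerivAt (fun t : ℝ => -Complex.log (z - t)) (1 / (z - (t : ℂ))) t := by
    intro t _
    have hs : z - (t : ℂ) ∈ Complex.slitPlane := by
      rw [Complex.mem_slitPlane_iff]; right; simp; exact hz.ne'
    refine ((hasDerivAt_sub_ofReal z t).clog_real hs).fun_neg.congr_deriv ?_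
    ring
  have hc : Continuous fun t : ℝ => 1 / (z - (t : ℂ)) :=
    Continuous.div (by fun_prop) (by fun_prop) (sub_ofReal_ne_zero hz)
  rw [intervalIntegral.integral_eq_sub_of_hasDerivAt hd (hc.intervalIntegrable _ _)]
  have hn : ‖z - ((z.re + r : ℝ) : ℂ)‖ = ‖z - ((z.re - r : ℝ) : ℂ)‖ := by
    simp [Complex.norm_def, Complex.normSq_apply]
  rw [neg_sub_neg, Complex.log, Complex.log, hn, add_sub_add_left_eq_sub, ← sub_mul,
    ← Complex.ofReal_sub, norm_mul, Complex.norm_I, mul_one, Complex.norm_real, Real.norm_eq_abs]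
  have h1 := Complex.abs_arg_le_pi (z - ((z.re - r : ℝ) : ℂ))
  have h2 := Complex.abs_arg_le_pi (z - ((z.re + r : ℝ) : ℂ))
  have := abs_sub (Complex.arg (z - ((z.re - r : ℝ) : ℂ))) (Complex.arg (z - ((z.re + r : ℝ) : ℂ)))
  linarith

/-- The kernel that bounds the part of a Cauchy transform away from the singularity. -/
noncomputable def tailKernel (a x t : ℝ) : ℝ := |t| ^ (-a) / (|t| + x)

theorem integrable_tailKernel_one {a : ℝ} (ha : 0 < a) (ha1 : a < 1) :
    Integrable (tailKernel a 1) := by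
  have hm : Measurable (tailKernel a 1) := by unfold tailKernel; fun_prop
  have h01 : IntegrableOn (tailKernel a 1) (Ioc 0 1) := by
    have := (intervalIntegral.intervalIntegrable_rpow' (a := 0) (b := 1)
      (show -1 < -a by linarith)).1
    refine Integrable.mono' this hm.aestronglyMeasurable ?_
    filter_upwards [ae_restrict_mem measurableSet_Ioc] with t ht
    have h1 : 0 ≤ t ^ (-a) := Real.rpow_nonneg ht.1.le _
    rw [tailKernel, abs_of_pos ht.1, Real.norm_eq_abs,
      abs_of_nonneg (div_nonneg h1 (by linarith [ht.1]))]
    exact div_le_self h1 (by linarith [ht.1])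
  have h1i : IntegrableOn (tailKernel a 1) (Ioi 1) := by
    refine Integrable.mono' (integrableOn_Ioi_rpow_of_lt (show -1 - a < -1 by linarith) one_pos)
      hm.aestronglyMeasurable ?_
    filter_upwards [ae_restrict_mem measurableSet_Ioi] with t ht
    have ht0 : 0 < t := one_pos.trans ht
    have h1 : 0 ≤ t ^ (-a) := Real.rpow_nonneg ht0.le _
    rw [tailKernel, abs_of_pos ht0, Real.norm_eq_abs, abs_of_nonneg (div_nonneg h1 (by linarith)),
      show -1 - a = -a - 1 by ring, Real.rpow_sub_one ht0.ne']
    exact div_le_div_of_nonneg_left h1 ht0 (by linarith)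
  have hpos : IntegrableOn (tailKernel a 1) (Ioi 0) := by
    rw [← Ioc_union_Ioi_eq_Ioi zero_le_one]; exact h01.union h1i
  have hneg : IntegrableOn (tailKernel a 1) (Iic 0) := by
    rw [← integrableOn_Ici_iff_integrableOn_Ioi] at hpos
    have := hpos.comp_neg
    rw [Set.neg_Ici, neg_zero] at this
    exact this.congr_fun (fun t _ => by simp [tailKernel]) measurableSet_Iic
  rw [← integrableOn_univ, ← Iic_union_Ioi (a := (0 : ℝ))]
  exact hneg.union hpos

theorem tailKernel_eq {a x : ℝ} (hx : 0 < x) (t : ℝ) :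
    tailKernel a x t = x ^ (-a - 1) * tailKernel a 1 (t / x) := by
  unfold tailKernel
  rw [abs_div, abs_of_pos hx, Real.div_rpow (abs_nonneg _) hx.le, Real.rpow_sub_one hx.ne']
  have := (Real.rpow_pos_of_pos hx (-a)).ne'
  have h2 : |t| + x ≠ 0 := by positivity
  have h3 : |t| / x + 1 ≠ 0 := by positivity
  field_simp

theorem integrable_tailKernel {a x : ℝ} (ha : 0 < a) (ha1 : a < 1) (hx : 0 < x) :
    Integrable (tailKernel a x) := by
  rw [funext (tailKernel_eq (a := a) hx)]
  exact ((integrable_tailKernel_one ha ha1).comp_div hx.ne').const_mul _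

theorem integral_tailKernel {a x : ℝ} (hx : 0 < x) :
    ∫ t, tailKernel a x t = x ^ (-a) * ∫ t, tailKernel a 1 t := by
  simp_rw [tailKernel_eq (a := a) hx]
  rw [integral_const_mul, Measure.integral_comp_div, abs_of_pos hx, smul_eq_mul, ← mul_assoc,
    ← Real.rpow_add_one hx.ne', sub_add_cancel]

theorem integral_tailKernel_nonneg (a : ℝ) : 0 ≤ ∫ t, tailKernel a 1 t :=
  integral_nonneg fun t => by unfold tailKernel; positivity

/-- The constant in the decay estimate for Cauchy transforms. -/
noncomputable def cauchyConst (a : ℝ) : ℝ := 2 * Real.pi + 3 * (∫ t, tailKernel a 1 t) + 8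

theorem cauchyConst_pos (a : ℝ) : 0 < cauchyConst a := by
  have := integral_tailKernel_nonneg a
  have := Real.pi_pos
  unfold cauchyConst; linarith

theorem C1Decay.nonneg {a M N : ℝ} {G G' : ℝ → ℝ} (h : C1Decay a M N G G') : 0 ≤ M ∧ 0 ≤ N := by
  have h1 := (abs_nonneg _).trans (h.bound 0)
  have h2 := (abs_nonneg _).trans (h.bound_deriv 0)
  simp at h1 h2
  exact ⟨h1, h2⟩

theorem norm_setIntegral_far_le {a M ε : ℝ} (ha : 0 < a) (ha1 : a < 1) {G : ℝ → ℝ}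
    (hM : 0 ≤ M) (hb : ∀ t, |G t| ≤ M * (1 + |t|) ^ (-a)) {z : ℂ} (hx : 0 < z.re)
    (hε : 0 < ε) (hε1 : ε ≤ 1) :
    ‖∫ t in (Ioc (z.re - ε * z.re) (z.re + ε * z.re))ᶜ, (G t : ℂ) / (z - t)‖ ≤
      3 * (∫ t, tailKernel a 1 t) * (M / ε) * z.re ^ (-a) := by
  have hi := (integrable_tailKernel ha ha1 hx).const_mul (3 * (M / ε))
  have hk : ∀ t, 0 ≤ 3 * (M / ε) * tailKernel a z.re t := fun t => by
    unfold tailKernel; positivity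
  refine (norm_integral_le_of_norm_le hi.integrableOn ?_).trans
    ((setIntegral_le_integral hi (Eventually.of_forall hk)).trans_eq ?_)
  · have h0 : ∀ᵐ t : ℝ, t ≠ 0 := by simp [ae_iff]
    filter_upwards [ae_restrict_mem measurableSet_Ioc.compl, ae_restrict_of_ae h0] with t ht ht0
    have hfar : ε * z.re ≤ |z.re - t| := by
      by_contra! hlt
      obtain ⟨h1, h2⟩ := abs_lt.1 hlt
      exact ht ⟨by linarith, by linarith⟩
    have hpos : 0 < |z.re - t| := (mul_pos hε hx).trans_le hfar
    have hre : |z.re - t| ≤ ‖z - t‖ := by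
      simpa using Complex.abs_re_le_norm (z - t)
    have ht' : 0 < |t| := abs_pos.2 ht0
    have h1 : |t| + z.re ≤ 3 / ε * |z.re - t| := by
      have h2 : |t| ≤ |z.re - t| + z.re := by
        have := abs_sub_abs_le_abs_sub t z.re
        rw [abs_of_pos hx, abs_sub_comm] at this
        linarith
      rw [div_mul_eq_mul_div, le_div_iff₀ hε]
      nlinarith
    have h2 : (1 + |t|) ^ (-a) ≤ |t| ^ (-a) :=
      Real.rpow_le_rpow_of_nonpos ht' (by linarith) (by linarith)
    have h3 : 0 ≤ |t| ^ (-a) := by positivity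
    rw [norm_div, Complex.norm_real, Real.norm_eq_abs, tailKernel, div_le_iff₀ (hpos.trans_le hre)]
    calc |G t| ≤ M * |t| ^ (-a) := (hb t).trans (mul_le_mul_of_nonneg_left h2 hM)
      _ = M * (|t| ^ (-a) / (|t| + z.re)) * (|t| + z.re) := by field_simp
      _ ≤ M * (|t| ^ (-a) / (|t| + z.re)) * (3 / ε * ‖z - t‖) := by
          refine mul_le_mul_of_nonneg_left (h1.trans ?_) (by positivity)
          exact mul_le_mul_of_nonneg_left hre (by positivity)
      _ = _ := by ring
  · rw [integral_const_mul, integral_tailKernel hx]; ring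

theorem C1Decay.abs_sub_le {a M N : ℝ} (ha : 0 < a) (ha1 : a < 1) {G G' : ℝ → ℝ}
    (h : C1Decay a M N G G') {x t : ℝ} (hx : 0 < x) (ht : x / 2 ≤ t) :
    |G t - G x| ≤ 4 * N * x ^ (-1 - a) * |t - x| := by
  refine Convex.norm_image_sub_le_of_norm_hasDerivWithin_le (s := Ici (x / 2)) (f := G) (f' := G')
    (fun s _ => (h.hasDerivAt s).hasDerivWithinAt) (fun s hs => ?_) (convex_Ici _)
    (show x / 2 ≤ x by linarith) ht
  have hs' : x / 2 ≤ s := hs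
  have h1 : (1 + |s|) ^ (-1 - a) ≤ (x / 2) ^ (-1 - a) :=
    Real.rpow_le_rpow_of_nonpos (by linarith) (by linarith [le_abs_self s]) (by linarith)
  have h2 : (x / 2) ^ (-1 - a) ≤ 4 * x ^ (-1 - a) := by
    rw [Real.div_rpow hx.le zero_le_two, div_eq_mul_inv, ← Real.rpow_neg zero_le_two, mul_comm]
    refine mul_le_mul_of_nonneg_right ?_ (by positivity)
    calc (2 : ℝ) ^ (-(-1 - a)) ≤ 2 ^ (2 : ℝ) :=
          Real.rpow_le_rpow_of_exponent_le one_le_two (by linarith)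
      _ = 4 := by norm_num
  rw [Real.norm_eq_abs]
  calc |G' s| ≤ N * (1 + |s|) ^ (-1 - a) := h.bound_deriv s
    _ ≤ N * (4 * x ^ (-1 - a)) := mul_le_mul_of_nonneg_left (h1.trans h2) h.nonneg.2
    _ = _ := by ring

theorem C1Decay.norm_cauchy_le {a M N ε : ℝ} (ha : 0 < a) (ha1 : a < 1) {G G' : ℝ → ℝ}
    (h : C1Decay a M N G G') {z : ℂ} (hx : 0 < z.re) (hz : 0 < z.im) (hε : 0 < ε)
    (hε1 : ε ≤ 1 / 2) :
    ‖cauchy G z‖ ≤ cauchyConst a * (M / ε + N * ε) * z.re ^ (-a) := by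
  obtain ⟨hM, hN⟩ := h.nonneg
  have hi := integrable_div_sub ha h.continuous h.bound hz
  set r := ε * z.re with hr
  have hr0 : 0 < r := mul_pos hε hx
  have hfar := norm_setIntegral_far_le ha ha1 hM h.bound hx hε (by linarith)
  have hsplit := integral_add_compl
    (measurableSet_Ioc (a := z.re - r) (b := z.re + r)) hi
  have hle : z.re - r ≤ z.re + r := by linarith
  have hci : Continuous fun t : ℝ => 1 / (z - (t : ℂ)) :=
    Continuous.div (by fun_prop) (by fun_prop) (sub_ofReal_ne_zero hz)
  have hc2 : Continuous fun t : ℝ => ((G t - G z.re : ℝ) : ℂ) / (z - t) :=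
    Continuous.div (by have := h.continuous; fun_prop) (by fun_prop) (sub_ofReal_ne_zero hz)
  have hnear : ∫ t in Ioc (z.re - r) (z.re + r), (G t : ℂ) / (z - t) =
      (∫ t in (z.re - r)..(z.re + r), ((G t - G z.re : ℝ) : ℂ) / (z - t)) +
      (G z.re : ℂ) * ∫ t in (z.re - r)..(z.re + r), 1 / (z - (t : ℂ)) := by
    rw [← intervalIntegral.integral_const_mul, ← intervalIntegral.integral_add
      (hc2.intervalIntegrable _ _) ((hci.const_mul _).intervalIntegrable _ _),
      intervalIntegral.integral_of_le hle]
    congr 1 with t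
    push_cast
    ring
  have hp := Real.rpow_nonneg hx.le (-a)
  have hn1 : ‖∫ t in (z.re - r)..(z.re + r), ((G t - G z.re : ℝ) : ℂ) / (z - t)‖ ≤
      8 * (N * ε) * z.re ^ (-a) := by
    have := intervalIntegral.norm_integral_le_of_norm_le_const
      (a := z.re - r) (b := z.re + r) (C := 4 * N * z.re ^ (-1 - a))
      (f := fun t : ℝ => ((G t - G z.re : ℝ) : ℂ) / (z - t)) (fun t ht => by
        rw [uIoc_of_le hle] at ht
        have hn : 0 < ‖z - t‖ := hz.trans_le (im_le_norm_sub_ofReal z t)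
        rw [norm_div, Complex.norm_real, Real.norm_eq_abs, div_le_iff₀ hn]
        refine (h.abs_sub_le ha ha1 hx (by nlinarith [ht.1])).trans ?_
        refine mul_le_mul_of_nonneg_left ?_ (by positivity)
        rw [abs_sub_comm]
        simpa using Complex.abs_re_le_norm (z - t))
    refine this.trans_eq ?_
    rw [add_sub_sub_cancel, abs_of_pos (by linarith), hr, show -1 - a = -a - 1 by ring,
      Real.rpow_sub_one hx.ne']
    field_simp
    ring
  have hGx : |G z.re| ≤ M * z.re ^ (-a) := by
    refine (h.bound _).trans (mul_le_mul_of_nonneg_left ?_ hM)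
    exact Real.rpow_le_rpow_of_nonpos hx (by linarith [le_abs_self z.re]) (by linarith)
  have hn2 : ‖(G z.re : ℂ) * ∫ t in (z.re - r)..(z.re + r), 1 / (z - (t : ℂ))‖ ≤
      2 * Real.pi * (M / ε) * z.re ^ (-a) := by
    rw [norm_mul, Complex.norm_real, Real.norm_eq_abs]
    have h1 : M ≤ M / ε := le_div_self hM hε (by linarith)
    calc _ ≤ M * z.re ^ (-a) * (2 * Real.pi) :=
          mul_le_mul hGx (norm_integral_inv_sub_le hz r) (norm_nonneg _) (by positivity)
      _ ≤ M / ε * z.re ^ (-a) * (2 * Real.pi) := by gcongr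
      _ = _ := by ring
  have hJ := integral_tailKernel_nonneg a
  calc ‖cauchy G z‖ ≤ 8 * (N * ε) * z.re ^ (-a) + 2 * Real.pi * (M / ε) * z.re ^ (-a) +
        3 * (∫ t, tailKernel a 1 t) * (M / ε) * z.re ^ (-a) := by
        unfold cauchy
        rw [← hsplit, hnear]
        exact (norm_add_le _ _).trans (add_le_add ((norm_add_le _ _).trans (add_le_add hn1 hn2)) hfar)
    _ ≤ _ := by
        have e1 : 0 ≤ M / ε := by positivity
        have e2 : 0 ≤ N * ε := by positivity
        have e3 := Real.pi_pos
        rw [← add_mul, ← add_mul]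
        refine mul_le_mul_of_nonneg_right ?_ hp
        unfold cauchyConst
        have e4 : 0 ≤ (2 * Real.pi + 3 * ∫ t, tailKernel a 1 t) * (N * ε) := by positivity
        nlinarith

section Smooth

variable {a : ℝ} {A : ℕ → ℝ} {F : ℝ → ℝ}

theorem hasDerivAt_iteratedDeriv (hF : ContDiff ℝ ∞ F) (m : ℕ) (t : ℝ) :
    HasDerivAt (iteratedDeriv m F) (iteratedDeriv (m + 1) F t) t := by
  rw [iteratedDeriv_succ]
  exact ((hF.differentiable_iteratedDeriv m (by exact_mod_cast WithTop.coe_lt_top _)) t).hasDerivAt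

theorem abs_pow_mul_le {b : ℝ} {m : ℕ} {C g t : ℝ} (h : |g| ≤ C * (1 + |t|) ^ (-(m : ℝ) + b)) :
    |t ^ m * g| ≤ C * (1 + |t|) ^ b := by
  have h0 : 0 < 1 + |t| := by positivity
  rw [abs_mul, abs_pow]
  calc |t| ^ m * |g| ≤ (1 + |t|) ^ m * (C * (1 + |t|) ^ (-(m : ℝ) + b)) := by
        gcongr; linarith
    _ = C * (1 + |t|) ^ b := by
        rw [Real.rpow_add h0, Real.rpow_neg h0.le, Real.rpow_natCast]
        field_simp

theorem c1Decay_iteratedDeriv (hF : ContDiff ℝ ∞ F)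
    (hA : ∀ (k : ℕ) (x : ℝ), |iteratedDeriv k F x| ≤ A k * (1 + |x|) ^ (-(k : ℝ) - a)) (m : ℕ) :
    C1Decay a (A m) (A (m + 1)) (iteratedDeriv m F) (iteratedDeriv (m + 1) F) := by
  have hA0 : ∀ k, 0 ≤ A k := fun k => by
    have := (abs_nonneg _).trans (hA k 0)
    simpa using this
  refine ⟨hasDerivAt_iteratedDeriv hF m, hF.continuous_iteratedDeriv _ (by exact_mod_cast le_top),
    fun t => (hA m t).trans ?_, fun t => (hA (m + 1) t).trans ?_⟩ <;>
  refine mul_le_mul_of_nonneg_left (Real.rpow_le_rpow_of_exponent_le ?_ ?_) (hA0 _)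
  · linarith [abs_nonneg t]
  · linarith [Nat.cast_nonneg (α := ℝ) m]
  · linarith [abs_nonneg t]
  · push_cast; linarith [Nat.cast_nonneg (α := ℝ) m]

theorem c1Decay_moment (hF : ContDiff ℝ ∞ F)
    (hA : ∀ (k : ℕ) (x : ℝ), |iteratedDeriv k F x| ≤ A k * (1 + |x|) ^ (-(k : ℝ) - a)) (m : ℕ) :
    C1Decay a (A m) (m * A m + A (m + 1)) (fun t => t ^ m * iteratedDeriv m F t)
      (fun t => m * t ^ (m - 1) * iteratedDeriv m F t + t ^ m * iteratedDeriv (m + 1) F t) := by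
  have hc := fun k : ℕ => hF.continuous_iteratedDeriv k (by exact_mod_cast le_top)
  refine ⟨fun t => (hasDerivAt_pow m t).mul (hasDerivAt_iteratedDeriv hF m t), ?_, fun t => ?_,
    fun t => ?_⟩
  · have := hc m; have := hc (m + 1); fun_prop
  · exact abs_pow_mul_le (by simpa [sub_eq_add_neg] using hA m t)
  · have h1 : |t ^ m * iteratedDeriv (m + 1) F t| ≤ A (m + 1) * (1 + |t|) ^ (-1 - a) := by
      refine abs_pow_mul_le ((hA (m + 1) t).trans_eq ?_)
      congr 2; push_cast; ring
    have h2 : |m * t ^ (m - 1) * iteratedDeriv m F t| ≤ m * A m * (1 + |t|) ^ (-1 - a) := by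
      rcases m with _ | m
      · simp
      · rw [mul_assoc, abs_mul, Nat.abs_cast, mul_assoc]
        refine mul_le_mul_of_nonneg_left ?_ (Nat.cast_nonneg _)
        refine abs_pow_mul_le ((hA (m + 1) t).trans_eq ?_)
        congr 2; push_cast; ring
    rw [add_mul]
    exact (abs_add_le _ _).trans (add_le_add h2 h1)

theorem hasDerivAt_cauchy_iteratedDeriv (ha : 0 < a) (hF : ContDiff ℝ ∞ F)
    (hA : ∀ (k : ℕ) (x : ℝ), |iteratedDeriv k F x| ≤ A k * (1 + |x|) ^ (-(k : ℝ) - a)) (m : ℕ)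
    {z : ℂ} (hz : 0 < z.im) :
    HasDerivAt (cauchy (iteratedDeriv m F)) (cauchy (iteratedDeriv (m + 1) F) z) z :=
  (c1Decay_iteratedDeriv hF hA m).hasDerivAt_cauchy ha hz

theorem pow_mul_cauchy_iteratedDeriv (ha : 0 < a) (hF : ContDiff ℝ ∞ F)
    (hA : ∀ (k : ℕ) (x : ℝ), |iteratedDeriv k F x| ≤ A k * (1 + |x|) ^ (-(k : ℝ) - a)) (m : ℕ)
    {z : ℂ} (hz : 0 < z.im) :
    z ^ m * cauchy (iteratedDeriv m F) z = cauchy (fun t => t ^ m * iteratedDeriv m F t) z := by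
  induction m generalizing z with
  | zero => simp
  | succ m ih =>
    have hm := c1Decay_moment hF hA m
    have hm1 := c1Decay_moment hF hA (m + 1)
    have hd := hm.hasDerivAt_cauchy ha hz
    have hd' := (hasDerivAt_pow m z).fun_mul (hasDerivAt_cauchy_iteratedDeriv ha hF hA m hz)
    have hev : (fun w => w ^ m * cauchy (iteratedDeriv m F) w) =ᶠ[𝓝 z]
        cauchy (fun t => t ^ m * iteratedDeriv m F t) := by
      filter_upwards [(isOpen_lt continuous_const Complex.continuous_im).mem_nhds hz] with w hw
      exact ih hw
    have e1 := hd.unique (hd'.congr_of_eventuallyEq hev.symm)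
    have e2 := hm.mul_cauchy_deriv ha hz
    have i1 := integrable_div_sub ha hm.continuous hm.bound hz
    have i2 := integrable_div_sub ha hm1.continuous hm1.bound hz
    have e3 : cauchy (fun t => t * (m * t ^ (m - 1) * iteratedDeriv m F t +
        t ^ m * iteratedDeriv (m + 1) F t)) z =
        m * cauchy (fun t => t ^ m * iteratedDeriv m F t) z +
        cauchy (fun t => t ^ (m + 1) * iteratedDeriv (m + 1) F t) z := by
      unfold cauchy
      rw [← integral_const_mul, ← integral_add (i1.const_mul _) i2]
      congr 1 with t
      rcases m with _ | m
      · simp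
      · push_cast
        ring
    rw [e3, e1, ← ih hz] at e2
    have e4 : z * (m * z ^ (m - 1)) = m * z ^ m := by
      rcases m with _ | m
      · simp
      · simp only [Nat.add_sub_cancel]; ring
    rw [← add_left_cancel_iff (a := ↑m * (z ^ m * cauchy (iteratedDeriv m F) z)), ← e2]
    linear_combination -(cauchy (iteratedDeriv m F) z) * e4

/-- Decay constants for the derivatives of the Cauchy transform. -/
noncomputable def decayConst (a : ℝ) (A : ℕ → ℝ) (m : ℕ) : ℝ :=
  cauchyConst a * (2 * A m + (m * A m + A (m + 1)) / 2)

theorem norm_pow_mul_cauchy_le (ha : 0 < a) (ha1 : a < 1) (hF : ContDiff ℝ ∞ F)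
    (hA : ∀ (k : ℕ) (x : ℝ), |iteratedDeriv k F x| ≤ A k * (1 + |x|) ^ (-(k : ℝ) - a)) (m : ℕ)
    {z : ℂ} (hx : 0 < z.re) (hz : 0 < z.im) :
    ‖z‖ ^ m * ‖cauchy (iteratedDeriv m F) z‖ ≤ decayConst a A m * z.re ^ (-a) := by
  rw [← norm_pow, ← norm_mul, pow_mul_cauchy_iteratedDeriv ha hF hA m hz]
  refine ((c1Decay_moment hF hA m).norm_cauchy_le ha ha1 hx hz one_half_pos le_rfl).trans_eq ?_
  unfold decayConst
  ring

end Smooth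

/-- The real part of `c` times the Cauchy transform of the `m`-th derivative of `F`, at `x + iY`. -/
noncomputable def slice (c : ℂ) (m : ℕ) (F : ℝ → ℝ) (x Y : ℝ) : ℝ :=
  (c * cauchy (iteratedDeriv m F) ⟨x, Y⟩).re

theorem slice_mul_real (σ : ℝ) (c : ℂ) (m : ℕ) (F : ℝ → ℝ) (x Y : ℝ) :
    slice (σ * c) m F x Y = σ * slice c m F x Y := by
  unfold slice; rw [mul_assoc, Complex.re_ofReal_mul]

section Slice

variable {a : ℝ} {A : ℕ → ℝ} {F : ℝ → ℝ} {f : ℝ → ℝ → ℝ} {c : ℂ} {m : ℕ}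

theorem hasDerivAt_slice_fst (ha : 0 < a) (hF : ContDiff ℝ ∞ F)
    (hA : ∀ (k : ℕ) (x : ℝ), |iteratedDeriv k F x| ≤ A k * (1 + |x|) ^ (-(k : ℝ) - a))
    (x : ℝ) {Y : ℝ} (hY : 0 < Y) :
    HasDerivAt (fun s => slice c m F s Y) (slice c (m + 1) F x Y) x := by
  have h1 : HasDerivAt (fun s : ℝ => (⟨s, Y⟩ : ℂ)) 1 x := by
    have := (Complex.ofRealCLM.hasDerivAt (x := x)).add_const (Y * Complex.I)
    simpa [← Complex.mk_eq_add_mul_I] using this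
  have h2 := (hasDerivAt_cauchy_iteratedDeriv ha hF hA m (z := ⟨x, Y⟩) hY).comp x h1
  have h3 := Complex.reCLM.hasFDerivAt.comp_hasDerivAt x (h2.const_mul c)
  refine h3.congr_deriv ?_
  rw [Complex.reCLM_apply, slice, mul_one]

theorem hasDerivAt_slice_snd (ha : 0 < a) (hF : ContDiff ℝ ∞ F)
    (hA : ∀ (k : ℕ) (x : ℝ), |iteratedDeriv k F x| ≤ A k * (1 + |x|) ^ (-(k : ℝ) - a))
    (x : ℝ) {Y : ℝ} (hY : 0 < Y) :
    HasDerivAt (fun s => slice c m F x s) (slice (c * Complex.I) (m + 1) F x Y) Y := by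
  have h1 : HasDerivAt (fun s : ℝ => (⟨x, s⟩ : ℂ)) Complex.I Y := by
    have := ((Complex.ofRealCLM.hasDerivAt (x := Y)).mul_const Complex.I).const_add (x : ℂ)
    simpa [← Complex.mk_eq_add_mul_I] using this
  have h2 := (hasDerivAt_cauchy_iteratedDeriv ha hF hA m (z := ⟨x, Y⟩) hY).comp Y h1
  have h3 := Complex.reCLM.hasFDerivAt.comp_hasDerivAt Y (h2.const_mul c)
  refine h3.congr_deriv ?_
  rw [Complex.reCLM_apply, slice]
  congr 1; ring

theorem dx_eq_slice (ha : 0 < a) (hF : ContDiff ℝ ∞ F)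
    (hA : ∀ (k : ℕ) (x : ℝ), |iteratedDeriv k F x| ≤ A k * (1 + |x|) ^ (-(k : ℝ) - a))
    (hf : ∀ x Y, 0 < Y → f x Y = slice c m F x Y) (x Y : ℝ) (hY : 0 < Y) :
    dx f x Y = slice c (m + 1) F x Y := by
  rw [dx, funext fun s => hf s Y hY]
  exact (hasDerivAt_slice_fst ha hF hA x hY).deriv

theorem dY_eq_slice (ha : 0 < a) (hF : ContDiff ℝ ∞ F)
    (hA : ∀ (k : ℕ) (x : ℝ), |iteratedDeriv k F x| ≤ A k * (1 + |x|) ^ (-(k : ℝ) - a))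
    (hf : ∀ x Y, 0 < Y → f x Y = slice c m F x Y) (x Y : ℝ) (hY : 0 < Y) :
    dY f x Y = slice (c * Complex.I) (m + 1) F x Y := by
  refine ((hasDerivAt_slice_snd ha hF hA x hY).congr_of_eventuallyEq ?_).deriv
  filter_upwards [Ioi_mem_nhds hY] with s hs using hf x s hs

theorem mixed_eq_slice (ha : 0 < a) (hF : ContDiff ℝ ∞ F)
    (hA : ∀ (k : ℕ) (x : ℝ), |iteratedDeriv k F x| ≤ A k * (1 + |x|) ^ (-(k : ℝ) - a))
    (hf : ∀ x Y, 0 < Y → f x Y = slice c m F x Y) (k j : ℕ) (x Y : ℝ) (hY : 0 < Y) :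
    mixed k j f x Y = slice (c * Complex.I ^ j) (m + j + k) F x Y := by
  have h1 : ∀ j : ℕ, ∀ x Y, 0 < Y → dY^[j] f x Y = slice (c * Complex.I ^ j) (m + j) F x Y := by
    intro j
    induction j with
    | zero => simpa using hf
    | succ j ih =>
      intro x Y hY
      rw [Function.iterate_succ_apply', dY_eq_slice ha hF hA ih x Y hY, pow_succ, mul_assoc,
        add_assoc]
  have h2 : ∀ k : ℕ, ∀ x Y, 0 < Y →
      dx^[k] (dY^[j] f) x Y = slice (c * Complex.I ^ j) (m + j + k) F x Y := by
    intro k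
    induction k with
    | zero => simpa using h1 j
    | succ k ih =>
      intro x Y hY
      rw [Function.iterate_succ_apply', dx_eq_slice ha hF hA ih x Y hY, add_assoc]
  exact h2 k x Y hY

theorem abs_slice_le (hc : ‖c‖ ≤ 1) (x Y : ℝ) :
    |slice c m F x Y| ≤ ‖cauchy (iteratedDeriv m F) ⟨x, Y⟩‖ := by
  refine (Complex.abs_re_le_norm _).trans ?_
  rw [norm_mul]
  exact mul_le_of_le_one_left (norm_nonneg _) hc

theorem norm_cauchy_iteratedDeriv_le (ha : 0 < a) (ha1 : a < 1) (hF : ContDiff ℝ ∞ F)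
    (hA : ∀ (k : ℕ) (x : ℝ), |iteratedDeriv k F x| ≤ A k * (1 + |x|) ^ (-(k : ℝ) - a))
    (m : ℕ) {x Y : ℝ} (hx : 0 < x) (hY : 0 < Y) :
    ‖cauchy (iteratedDeriv m F) ⟨x, Y⟩‖ ≤ decayConst a A m * x ^ (-(m : ℝ) - a) := by
  have h := norm_pow_mul_cauchy_le ha ha1 hF hA m (z := ⟨x, Y⟩) hx hY
  have hz : x ≤ ‖(⟨x, Y⟩ : ℂ)‖ := (le_abs_self _).trans (Complex.abs_re_le_norm ⟨x, Y⟩)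
  have hp : x ^ m * ‖cauchy (iteratedDeriv m F) ⟨x, Y⟩‖ ≤ decayConst a A m * x ^ (-a) :=
    (mul_le_mul_of_nonneg_right (pow_le_pow_left₀ hx.le hz m) (norm_nonneg _)).trans h
  rw [sub_eq_add_neg, Real.rpow_add hx, Real.rpow_neg hx.le, Real.rpow_natCast]
  rw [← le_div_iff₀' (by positivity)] at hp
  exact hp.trans_eq (by ring)

theorem mul_norm_cauchy_iteratedDeriv_le (ha : 0 < a) (ha1 : a < 1) (hF : ContDiff ℝ ∞ F)
    (hA : ∀ (k : ℕ) (x : ℝ), |iteratedDeriv k F x| ≤ A k * (1 + |x|) ^ (-(k : ℝ) - a))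
    {m : ℕ} (hm : 1 ≤ m) {x Y : ℝ} (hx : 0 < x) (hY : 0 < Y) :
    Y * ‖cauchy (iteratedDeriv m F) ⟨x, Y⟩‖ ≤ decayConst a A m * x ^ (-(m : ℝ) + 1 - a) := by
  obtain ⟨m, rfl⟩ := Nat.exists_eq_add_of_le' hm
  have h := norm_pow_mul_cauchy_le ha ha1 hF hA (m + 1) (z := ⟨x, Y⟩) hx hY
  have hz : x ≤ ‖(⟨x, Y⟩ : ℂ)‖ := (le_abs_self _).trans (Complex.abs_re_le_norm ⟨x, Y⟩)
  have hz' : Y ≤ ‖(⟨x, Y⟩ : ℂ)‖ := (le_abs_self _).trans (Complex.abs_im_le_norm ⟨x, Y⟩)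
  have hp : x ^ m * (Y * ‖cauchy (iteratedDeriv (m + 1) F) ⟨x, Y⟩‖) ≤
      decayConst a A (m + 1) * x ^ (-a) := by
    refine le_trans ?_ h
    rw [← mul_assoc, pow_succ]
    gcongr
  rw [show -((m + 1 : ℕ) : ℝ) + 1 - a = -(m : ℝ) + -a by push_cast; ring, Real.rpow_add hx,
    Real.rpow_neg hx.le, Real.rpow_natCast]
  rw [← le_div_iff₀' (by positivity)] at hp
  exact hp.trans_eq (by ring)

theorem abs_mixed_le (ha : 0 < a) (ha1 : a < 1) (hF : ContDiff ℝ ∞ F)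
    (hA : ∀ (k : ℕ) (x : ℝ), |iteratedDeriv k F x| ≤ A k * (1 + |x|) ^ (-(k : ℝ) - a))
    (hc : ‖c‖ ≤ 1) (hf : ∀ x Y, 0 < Y → f x Y = slice c 0 F x Y) (k j : ℕ) {x Y : ℝ}
    (hx : 0 < x) (hY : 0 < Y) :
    |mixed k j f x Y| ≤ decayConst a A (j + k) * x ^ (-(k : ℝ) - j - a) := by
  rw [mixed_eq_slice ha hF hA hf k j x Y hY, zero_add]
  refine (abs_slice_le (by simpa using hc) x Y).trans
    ((norm_cauchy_iteratedDeriv_le ha ha1 hF hA (j + k) hx hY).trans_eq ?_)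
  congr 2; push_cast; ring

theorem mul_abs_mixed_le (ha : 0 < a) (ha1 : a < 1) (hF : ContDiff ℝ ∞ F)
    (hA : ∀ (k : ℕ) (x : ℝ), |iteratedDeriv k F x| ≤ A k * (1 + |x|) ^ (-(k : ℝ) - a))
    (hc : ‖c‖ ≤ 1) (hf : ∀ x Y, 0 < Y → f x Y = slice c 0 F x Y) {k : ℕ} (hk : 1 ≤ k) {x Y : ℝ}
    (hx : 0 < x) (hY : 0 < Y) :
    Y * |mixed k 0 f x Y| ≤ decayConst a A (0 + k) * x ^ (-(k : ℝ) + 1 - a) := by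
  rw [mixed_eq_slice ha hF hA hf k 0 x Y hY, pow_zero, mul_one, zero_add]
  exact (mul_le_mul_of_nonneg_left (abs_slice_le hc x Y) hY.le).trans
    (by simpa using mul_norm_cauchy_iteratedDeriv_le ha ha1 hF hA hk hx hY)

theorem contDiffOn_slice (ha : 0 < a) (hF : ContDiff ℝ ∞ F)
    (hA : ∀ (k : ℕ) (x : ℝ), |iteratedDeriv k F x| ≤ A k * (1 + |x|) ^ (-(k : ℝ) - a))
    (hf : ∀ x Y, 0 < Y → f x Y = slice c m F x Y) :
    ContDiffOn ℝ ∞ (fun q : ℝ × ℝ => f q.1 q.2) upper := by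
  have hopen : IsOpen {z : ℂ | 0 < z.im} := isOpen_lt continuous_const Complex.continuous_im
  have h1 : DifferentiableOn ℂ (cauchy (iteratedDeriv m F)) {z : ℂ | 0 < z.im} := fun z hz =>
    (hasDerivAt_cauchy_iteratedDeriv ha hF hA m hz).differentiableAt.differentiableWithinAt
  have h2 : ContDiffOn ℝ ∞ (cauchy (iteratedDeriv m F)) {z : ℂ | 0 < z.im} :=
    (h1.contDiffOn hopen).restrict_scalars ℝ
  have h3 : ContDiffOn ℝ ∞ (fun z => (c * cauchy (iteratedDeriv m F) z).re) {z : ℂ | 0 < z.im} :=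
    Complex.reCLM.contDiff.comp_contDiffOn (contDiffOn_const.mul h2)
  have h4 := h3.comp (s := upper) (g := fun z : ℂ => (c * cauchy (iteratedDeriv m F) z).re)
    Complex.equivRealProdCLM.symm.contDiff.contDiffOn (fun q hq => hq)
  refine h4.congr fun q hq => ?_
  rw [hf q.1 q.2 hq, slice]
  rfl

end Slice

section Poisson

variable {a : ℝ} {A : ℕ → ℝ} {F : ℝ → ℝ}

theorem poisson_eq_slice (ha : 0 < a) (hF : ContDiff ℝ ∞ F)
    (hA : ∀ (k : ℕ) (x : ℝ), |iteratedDeriv k F x| ≤ A k * (1 + |x|) ^ (-(k : ℝ) - a))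
    (x Y : ℝ) (hY : 0 < Y) :
    poisson F x Y = slice ((Real.pi⁻¹ : ℝ) * Complex.I) 0 F x Y := by
  have hd := c1Decay_iteratedDeriv hF hA 0
  have hi := integrable_div_sub ha hd.continuous hd.bound (z := ⟨x, Y⟩) hY
  rw [slice_mul_real, slice, Complex.I_mul_re, poisson, if_pos hY, cauchy,
    ← Complex.imCLM_apply, ← ContinuousLinearMap.integral_comp_comm _ hi, ← integral_neg]
  congr 2 with t
  rw [iteratedDeriv_zero, Complex.imCLM_apply, Complex.div_im]
  simp [Complex.normSq_apply]
  ring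

theorem tendsto_slice_atTop_fst (ha : 0 < a) (ha1 : a < 1) (hF : ContDiff ℝ ∞ F)
    (hA : ∀ (k : ℕ) (x : ℝ), |iteratedDeriv k F x| ≤ A k * (1 + |x|) ^ (-(k : ℝ) - a))
    {c : ℂ} (hc : ‖c‖ ≤ 1) {Y : ℝ} (hY : 0 < Y) :
    Tendsto (fun x => slice c 0 F x Y) atTop (𝓝 0) := by
  have h1 : Tendsto (fun x : ℝ => decayConst a A 0 * x ^ (-(0 : ℕ) - a : ℝ)) atTop (𝓝 0) := by
    simpa using (tendsto_rpow_neg_atTop ha).const_mul (decayConst a A 0)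
  refine squeeze_zero_norm' ?_ h1
  filter_upwards [Ioi_mem_atTop 0] with x hx
  exact (abs_slice_le hc x Y).trans (norm_cauchy_iteratedDeriv_le ha ha1 hF hA 0 hx hY)

theorem integrableOn_slice_one (ha : 0 < a) (ha1 : a < 1) (hF : ContDiff ℝ ∞ F)
    (hA : ∀ (k : ℕ) (x : ℝ), |iteratedDeriv k F x| ≤ A k * (1 + |x|) ^ (-(k : ℝ) - a))
    {c : ℂ} (hc : ‖c‖ ≤ 1) (x : ℝ) {Y : ℝ} (hY : 0 < Y) :
    IntegrableOn (fun s => slice c 1 F s Y) (Ioi x) := by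
  have hcont : Continuous fun s => slice c 1 F s Y :=
    continuous_iff_continuousAt.2 fun s => (hasDerivAt_slice_fst ha hF hA s hY).continuousAt
  have h1 : IntegrableOn (fun s => slice c 1 F s Y) (Ioi 1) := by
    refine Integrable.mono' ((integrableOn_Ioi_rpow_of_lt (show -((1 : ℕ) : ℝ) - a < -1 by
      push_cast; linarith) one_pos).const_mul (decayConst a A 1))
      hcont.aestronglyMeasurable ?_
    filter_upwards [ae_restrict_mem measurableSet_Ioi] with s hs
    exact (abs_slice_le hc s Y).trans
      (norm_cauchy_iteratedDeriv_le ha ha1 hF hA 1 (one_pos.trans hs) hY)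
  refine ((hcont.integrableOn_Icc (a := x) (b := 1)).union h1).mono_set fun s hs => ?_
  rcases le_or_gt s 1 with h | h
  · exact Or.inl ⟨le_of_lt hs, h⟩
  · exact Or.inr h

theorem norm_inv_pi_le_one : ‖((Real.pi⁻¹ : ℝ) : ℂ)‖ ≤ 1 := by
  rw [Complex.norm_real, Real.norm_eq_abs, abs_of_pos (inv_pos.2 Real.pi_pos)]
  exact inv_le_one_of_one_le₀ (by linarith [Real.pi_gt_three])

theorem dY_poisson_eq (ha : 0 < a) (hF : ContDiff ℝ ∞ F)
    (hA : ∀ (k : ℕ) (x : ℝ), |iteratedDeriv k F x| ≤ A k * (1 + |x|) ^ (-(k : ℝ) - a))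
    (x Y : ℝ) (hY : 0 < Y) :
    dY (poisson F) x Y = -slice (Real.pi⁻¹ : ℝ) 1 F x Y := by
  rw [dY_eq_slice ha hF hA (poisson_eq_slice ha hF hA) x Y hY, mul_assoc, Complex.I_mul_I]
  simp [slice]

theorem integrableOn_dY_poisson (ha : 0 < a) (ha1 : a < 1) (hF : ContDiff ℝ ∞ F)
    (hA : ∀ (k : ℕ) (x : ℝ), |iteratedDeriv k F x| ≤ A k * (1 + |x|) ^ (-(k : ℝ) - a))
    (x Y : ℝ) (hY : 0 < Y) : IntegrableOn (fun θ => dY (poisson F) θ Y) (Ioi x) := by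
  simp_rw [fun θ => dY_poisson_eq ha hF hA θ Y hY]
  exact (integrableOn_slice_one ha ha1 hF hA norm_inv_pi_le_one x hY).neg

theorem tangential_eq_slice (ha : 0 < a) (ha1 : a < 1) (hF : ContDiff ℝ ∞ F)
    (hA : ∀ (k : ℕ) (x : ℝ), |iteratedDeriv k F x| ≤ A k * (1 + |x|) ^ (-(k : ℝ) - a))
    (x Y : ℝ) (hY : 0 < Y) :
    tangential (poisson F) x Y = slice (Real.pi⁻¹ : ℝ) 0 F x Y := by
  have hd := fun s => hasDerivAt_slice_fst (c := (Real.pi⁻¹ : ℝ)) (m := 0) ha hF hA s hY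
  have h := integral_Ioi_of_hasDerivAt_of_tendsto (hd x).continuousAt.continuousWithinAt
    (fun s _ => hd s) (integrableOn_slice_one ha ha1 hF hA norm_inv_pi_le_one x hY)
    (tendsto_slice_atTop_fst ha ha1 hF hA norm_inv_pi_le_one hY)
  rw [tangential]
  simp_rw [fun θ => dY_poisson_eq ha hF hA θ Y hY]
  rw [integral_neg, h]; ring

theorem tendsto_slice_atTop_snd (ha : 0 < a) (hF : ContDiff ℝ ∞ F)
    (hA : ∀ (k : ℕ) (x : ℝ), |iteratedDeriv k F x| ≤ A k * (1 + |x|) ^ (-(k : ℝ) - a))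
    (c : ℂ) (m : ℕ) (x : ℝ) :
    Tendsto (fun Y => slice c m F x Y) atTop (𝓝 0) := by
  have hd := c1Decay_iteratedDeriv hF hA m
  have hint := fun {z : ℂ} (hz : 0 < z.im) => integrable_div_sub ha hd.continuous hd.bound hz
  have h : Tendsto (fun Y : ℝ => ∫ t : ℝ, ((iteratedDeriv m F t : ℝ) : ℂ) / ((⟨x, Y⟩ : ℂ) - t)) atTop
      (𝓝 (∫ _ : ℝ, (0 : ℂ))) := by
    refine tendsto_integral_filter_of_dominated_convergence
      (fun t => ‖((iteratedDeriv m F t : ℝ) : ℂ) / ((⟨x, 1⟩ : ℂ) - t)‖) ?_ ?_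
      (hint (z := ⟨x, 1⟩) one_pos).norm ?_
    · filter_upwards [Ioi_mem_atTop 0] with Y hY
      exact (hint (z := ⟨x, Y⟩) hY).aestronglyMeasurable
    · filter_upwards [Ici_mem_atTop 1] with Y hY
      refine Eventually.of_forall fun t => ?_
      have hpos : 0 < ‖(⟨x, 1⟩ : ℂ) - t‖ :=
        norm_pos_iff.2 (sub_ofReal_ne_zero (z := ⟨x, 1⟩) one_pos t)
      rw [norm_div, norm_div]
      refine div_le_div_of_nonneg_left (norm_nonneg _) hpos ?_
      have hY' : (1 : ℝ) ≤ Y := hY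
      rw [Complex.norm_def, Complex.norm_def]
      refine Real.sqrt_le_sqrt ?_
      simp [Complex.normSq_apply]
      nlinarith
    · refine Eventually.of_forall fun t => ?_
      have h1 : Tendsto (fun Y : ℝ => |iteratedDeriv m F t| * Y⁻¹) atTop (𝓝 0) := by
        simpa using tendsto_inv_atTop_zero.const_mul |iteratedDeriv m F t|
      refine squeeze_zero_norm' ?_ h1
      filter_upwards [Ioi_mem_atTop 0] with Y hY
      rw [norm_div, Complex.norm_real, Real.norm_eq_abs, div_eq_mul_inv]
      exact mul_le_mul_of_nonneg_left
        (inv_anti₀ hY (im_le_norm_sub_ofReal ⟨x, Y⟩ t)) (abs_nonneg _)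
  rw [integral_zero] at h
  have := (Complex.continuous_re.tendsto _).comp (h.const_mul c)
  simpa [slice, cauchy, Function.comp_def] using this

theorem poisson_eq_integral_comp {x Y : ℝ} (hY : 0 ≤ Y) :
    poisson F x Y = Real.pi⁻¹ * ∫ s, F (x - Y * s) * (1 + s ^ 2)⁻¹ := by
  rcases hY.eq_or_lt with rfl | hY
  · simp only [poisson, lt_irrefl, if_false, zero_mul, sub_zero]
    rw [integral_const_mul, integral_univ_inv_one_add_sq]
    field_simp
  · rw [poisson, if_pos hY]
    congr 1
    have h1 := Measure.integral_comp_mul_left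
      (fun r => Y / (r ^ 2 + Y ^ 2) * F (x - r)) Y
    have h2 := integral_sub_left_eq_self (fun r => Y / (r ^ 2 + Y ^ 2) * F (x - r)) volume x
    simp only [sub_sub_cancel] at h2
    rw [h2]
    rw [abs_of_pos (inv_pos.2 hY), smul_eq_mul, eq_inv_mul_iff_mul_eq₀ hY.ne',
      ← integral_const_mul] at h1
    rw [← h1]
    congr 1 with s
    have : 1 + s ^ 2 ≠ 0 := by positivity
    have : (Y * s) ^ 2 + Y ^ 2 ≠ 0 := by positivity
    field_simp
    ring

theorem continuousOn_poisson {M : ℝ} (hF : Continuous F) (hM : ∀ x, |F x| ≤ M) (s : Set ℝ) :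
    ContinuousOn (fun q : ℝ × ℝ => poisson F q.1 q.2) (s ×ˢ Ici 0) := by
  have hc : Continuous fun q : ℝ × ℝ =>
      Real.pi⁻¹ * ∫ s, F (q.1 - q.2 * s) * (1 + s ^ 2)⁻¹ := by
    have hinv : Continuous fun s : ℝ => (1 + s ^ 2)⁻¹ :=
      Continuous.inv₀ (by fun_prop) fun s => by positivity
    refine continuous_const.mul (continuous_of_dominated (bound := fun s => M * (1 + s ^ 2)⁻¹)
      (fun q => ?_) (fun q => Eventually.of_forall fun s => ?_)
      (integrable_inv_one_add_sq.const_mul M) (Eventually.of_forall fun s => ?_))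
    · exact ((hF.comp (by fun_prop)).mul hinv).aestronglyMeasurable
    · have : 0 ≤ (1 + s ^ 2)⁻¹ := by positivity
      rw [norm_mul, Real.norm_eq_abs, Real.norm_of_nonneg this]
      exact mul_le_mul_of_nonneg_right (hM _) this
    · exact (hF.comp (by fun_prop)).mul continuous_const
  exact hc.continuousOn.congr fun q hq => poisson_eq_integral_comp hq.2

end Poisson

section Corrector

variable {a σ : ℝ} {A : ℕ → ℝ} {F : ℝ → ℝ} {vp : ℝ → ℝ → ℝ}

theorem dx_const_mul (b : ℝ) (f : ℝ → ℝ → ℝ) (x Y : ℝ) :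
    dx (fun x Y => b * f x Y) x Y = b * dx f x Y :=
  deriv_const_mul_field b

theorem dY_const_mul (b : ℝ) (f : ℝ → ℝ → ℝ) (x Y : ℝ) :
    dY (fun x Y => b * f x Y) x Y = b * dY f x Y :=
  deriv_const_mul_field b

theorem solves_corrector (ha : 0 < a) (ha1 : a < 1)
    (h : IsWallExtension a A (fun x => -vp x 0) F) : Solves σ vp (corrector σ F) := by
  obtain ⟨hext, hF, hA⟩ := h
  have hv := poisson_eq_slice ha hF hA
  have hu := tangential_eq_slice ha ha1 hF hA
  have sv := contDiffOn_slice ha hF hA hv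
  have su := contDiffOn_slice ha hF hA hu
  have hb : ∀ x, |F x| ≤ A 0 := fun x => by
    have hd := c1Decay_iteratedDeriv hF hA 0
    have := hd.bound x
    rw [iteratedDeriv_zero] at this
    refine this.trans (mul_le_of_le_one_right hd.nonneg.1 ?_)
    exact Real.rpow_le_one_of_one_le_of_nonpos (by linarith [abs_nonneg x]) (by linarith)
  have hcont := continuousOn_poisson hF.continuous hb (Ici 1)
  have hwall : ∀ x : ℝ, 1 ≤ x → poisson F x 0 = -vp x 0 := fun x hx => by
    simp [poisson, hext x hx]
  have hfar : ∀ x, Tendsto (fun Y => poisson F x Y) atTop (𝓝 0) := fun x => by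
    refine (tendsto_slice_atTop_snd ha hF hA ((Real.pi⁻¹ : ℝ) * Complex.I) 0 x).congr' ?_
    filter_upwards [Ioi_mem_atTop 0] with Y hY using (hv x Y hY).symm
  have hux := dx_eq_slice ha hF hA hu
  have huY := dY_eq_slice ha hF hA hu
  have hvx := dx_eq_slice ha hF hA hv
  have hvY := dY_poisson_eq ha hF hA
  refine ⟨⟨sv, fun x Y _ hY => ?_, hcont, hwall, fun x _ => hfar x,
    fun x Y _ hY => integrableOn_dY_poisson ha ha1 hF hA x Y hY, fun x Y _ _ => rfl⟩,
    fun gp hgp => ⟨su, sv, contDiffOn_const.mul su, contDiffOn_const.mul sv,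
      contDiffOn_const.mul su, ?_, ?_, ?_, ?_, ?_, ?_, hcont, continuousOn_const.mul hcont, hwall,
      fun x hx => ?_, fun x _ => hfar x, fun x _ => ?_⟩⟩
  · have hYY := dY_eq_slice ha hF hA (dY_eq_slice ha hF hA hv) x Y hY
    have hxx := dx_eq_slice ha hF hA hvx x Y hY
    simp only [corrector]
    rw [hYY, hxx, slice, slice, ← Complex.add_re]
    rw [show ∀ w : ℂ, ((Real.pi⁻¹ : ℝ) * Complex.I * Complex.I * Complex.I : ℂ) * w =
      -((Real.pi⁻¹ : ℝ) * Complex.I * w) from fun w => by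
        linear_combination ((Real.pi⁻¹ : ℝ) * Complex.I * w) * Complex.I_mul_I]
    simp
  · intro x Y _ _; simp only [corrector, dx_const_mul]; ring
  · intro x Y _ hY
    simp only [corrector, dx_const_mul, dY_const_mul]
    rw [hvx x Y hY, huY x Y hY]; ring
  · intro x Y _ _; simp only [corrector, dx_const_mul]; ring
  · intro x Y _ _; simp only [corrector, dx_const_mul]; ring
  · intro x Y _ hY
    simp only [corrector]
    rw [hux x Y hY, hvY x Y hY]; ring
  · intro x Y _ hY
    simp only [corrector, dx_const_mul, dY_const_mul]
    rw [hux x Y hY, hvY x Y hY]; ring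
  · simp only [corrector]
    rw [hwall x hx, hgp x hx]; ring
  · simpa [corrector] using (hfar x).const_mul σ

theorem decayBounds_corrector (ha : 0 < a) (ha1 : a < 1) (hσ : 0 ≤ σ) (hσ1 : σ < 1)
    {f : ℝ → ℝ} (h : IsWallExtension a A f F) :
    DecayBounds a (fun k j => decayConst a A (j + k)) (corrector σ F) := by
  obtain ⟨-, hF, hA⟩ := h
  have hv := poisson_eq_slice ha hF hA
  have hu := tangential_eq_slice ha ha1 hF hA
  have hg : ∀ x Y, 0 < Y → σ * poisson F x Y =
      slice (σ * ((Real.pi⁻¹ : ℝ) * Complex.I)) 0 F x Y := fun x Y hY => by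
    rw [slice_mul_real, hv x Y hY]
  have hh : ∀ x Y, 0 < Y → σ * tangential (poisson F) x Y =
      slice (σ * (Real.pi⁻¹ : ℝ)) 0 F x Y := fun x Y hY => by
    rw [slice_mul_real, hu x Y hY]
  have c1 := norm_inv_pi_le_one
  have c2 : ‖((Real.pi⁻¹ : ℝ) * Complex.I : ℂ)‖ ≤ 1 := by
    rwa [norm_mul, Complex.norm_I, mul_one]
  have cσ : ∀ c : ℂ, ‖c‖ ≤ 1 → ‖(σ : ℂ) * c‖ ≤ 1 := fun c hc => by
    rw [norm_mul, Complex.norm_real, Real.norm_of_nonneg hσ]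
    exact mul_le_one₀ hσ1.le (norm_nonneg _) hc
  refine ⟨fun k j x Y hx hY => ?_, fun k x Y hk hx hY => ?_⟩
  · have hx0 : 0 < x := by linarith
    exact ⟨abs_mixed_le ha ha1 hF hA c1 hu k j hx0 hY, abs_mixed_le ha ha1 hF hA c2 hv k j hx0 hY,
      abs_mixed_le ha ha1 hF hA (cσ _ c1) hh k j hx0 hY,
      abs_mixed_le ha ha1 hF hA (cσ _ c2) hg k j hx0 hY⟩
  · have hx0 : 0 < x := by linarith
    exact ⟨mul_abs_mixed_le ha ha1 hF hA c2 hv hk hx0 hY,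
      mul_abs_mixed_le ha ha1 hF hA (cσ _ c2) hg hk hx0 hY⟩

end Corrector

/-- Landau's interpolation inequality on a half line. -/
theorem abs_deriv_le_of_abs_le {f f' f'' : ℝ → ℝ} {x P Q h : ℝ}
    (hf : ∀ y ∈ Ici x, HasDerivWithinAt f (f' y) (Ici x) y)
    (hf' : ∀ y ∈ Ici x, HasDerivWithinAt f' (f'' y) (Ici x) y)
    (hP : ∀ y ∈ Ici x, |f y| ≤ P) (hQ : ∀ y ∈ Ici x, |f'' y| ≤ Q) (hh : 0 < h) :
    |f' x| ≤ 2 * P / h + Q * h := by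
  have hQ0 : 0 ≤ Q := (abs_nonneg _).trans (hQ x self_mem_Ici)
  have hsub : Icc x (x + h) ⊆ Ici x := fun y hy => hy.1
  have h1 : ∀ y ∈ Icc x (x + h), ‖f' y - f' x‖ ≤ Q * h := fun y hy => by
    refine (Convex.norm_image_sub_le_of_norm_hasDerivWithin_le hf' hQ (convex_Ici x) self_mem_Ici
      (hsub hy)).trans (mul_le_mul_of_nonneg_left ?_ hQ0)
    rw [Real.norm_of_nonneg (by linarith [hy.1])]
    linarith [hy.2]
  have h2 := Convex.norm_image_sub_le_of_norm_hasDerivWithin_le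
    (f := fun y => f y - f' x * y) (s := Icc x (x + h)) (x := x) (y := x + h)
    (fun y hy => ((hf y (hsub hy)).mono hsub).sub
      ((hasDerivWithinAt_id y _).const_mul (f' x))) (by simpa using h1)
    (convex_Icc _ _) ⟨le_rfl, by linarith⟩ ⟨by linarith, le_rfl⟩
  have e : f (x + h) - f' x * (x + h) - (f x - f' x * x) = f (x + h) - f x - h * f' x := by ring
  rw [e, add_sub_cancel_left, Real.norm_eq_abs, Real.norm_of_nonneg hh.le] at h2
  have h3 := hP (x + h) (by simp [hh.le])
  have h4 := hP x self_mem_Ici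
  have h5 : |h * f' x| ≤ 2 * P + Q * h * h := by
    rw [abs_le] at *
    constructor <;> linarith
  rw [abs_mul, abs_of_pos hh, ← le_div_iff₀' hh] at h5
  refine h5.trans_eq ?_
  field_simp

/-- A bound for the fields in terms of a bound `M` for the wall datum. -/
noncomputable def smallConst₀ (A : ℕ → ℝ) (M : ℝ) : ℝ :=
  cauchyConst (1 / 2) * (2 * M + √M + A 1 * √M)

/-- A bound for the fields and their first derivatives in terms of a bound `M` for the wall datum. -/
noncomputable def smallConst (A : ℕ → ℝ) (M : ℝ) : ℝ :=
  smallConst₀ A M + (2 + decayConst (1 / 2) A 2) * √(smallConst₀ A M)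

theorem tendsto_smallConst (A : ℕ → ℝ) : Tendsto (smallConst A) (𝓝 0) (𝓝 0) := by
  have : Continuous (smallConst A) := by unfold smallConst smallConst₀; fun_prop
  simpa [smallConst, smallConst₀] using this.tendsto 0

theorem isO_comp_abs_add {φ : ℝ → ℝ} (hφ : Tendsto φ (𝓝 0) (𝓝 0)) {m : ℝ → ℝ → ℝ} (hm : IsO m) :
    IsO fun δ σ => φ (|m δ σ| + δ) := by
  refine hφ.comp ?_
  have h1 : Tendsto (fun q : ℝ × ℝ => q.1) (𝓝[Ioi 0 ×ˢ Ici 0] ((0 : ℝ), (0 : ℝ))) (𝓝 0) :=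
    (continuous_fst.tendsto' ((0 : ℝ), (0 : ℝ)) 0 rfl).mono_left nhdsWithin_le_nhds
  simpa using hm.abs.add h1

theorem smallBounds_corrector {A : ℕ → ℝ} {f F : ℝ → ℝ} {M σ : ℝ} (hσ : 0 ≤ σ) (hσ1 : σ < 1)
    (hM : 0 < M) (h : IsWallExtension (1 / 2) A f F)
    (hFM : ∀ x, |F x| ≤ M * (1 + |x|) ^ (-(1 / 2) : ℝ)) :
    SmallBounds (smallConst A M) (corrector σ F) := by
  obtain ⟨-, hF, hA⟩ := h
  have ha : (0 : ℝ) < 1 / 2 := by norm_num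
  have ha1 : (1 / 2 : ℝ) < 1 := by norm_num
  have hv := poisson_eq_slice ha hF hA
  have hu := tangential_eq_slice ha ha1 hF hA
  have c1 := norm_inv_pi_le_one
  have c2 : ‖((Real.pi⁻¹ : ℝ) * Complex.I : ℂ)‖ ≤ 1 := by
    rwa [norm_mul, Complex.norm_I, mul_one]
  have hs : 0 < √M := Real.sqrt_pos.2 hM
  have hd := c1Decay_iteratedDeriv hF hA 0
  have hA1 : 0 ≤ A 1 := hd.nonneg.2
  have hd' : C1Decay (1 / 2) M (A 1) (iteratedDeriv 0 F) (iteratedDeriv 1 F) :=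
    ⟨hd.hasDerivAt, hd.continuous_deriv, by simpa using hFM, hd.bound_deriv⟩
  set Θ := smallConst₀ A M with hΘ
  have hΘ0 : 0 < Θ := mul_pos (cauchyConst_pos _) (by positivity)
  have hΘs : 0 < √Θ := Real.sqrt_pos.2 hΘ0
  have hD : 0 ≤ decayConst (1 / 2) A 2 := by
    have := (norm_nonneg _).trans (norm_cauchy_iteratedDeriv_le ha ha1 hF hA 2 one_pos one_pos)
    simpa using this
  have hle : Θ ≤ smallConst A M := by
    have : 0 ≤ (2 + decayConst (1 / 2) A 2) * √Θ := by positivity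
    unfold smallConst; linarith
  have hle' : (2 + decayConst (1 / 2) A 2) * √Θ ≤ smallConst A M := by
    unfold smallConst; linarith
  have hbase : ∀ x Y : ℝ, 0 < x → 0 < Y →
      ‖cauchy (iteratedDeriv 0 F) ⟨x, Y⟩‖ ≤ Θ * x ^ (-(1 / 2) : ℝ) := by
    intro x Y hx hY
    have hε : 0 < min (1 / 2) √M := lt_min one_half_pos hs
    refine (hd'.norm_cauchy_le ha ha1 (z := ⟨x, Y⟩) hx hY hε (min_le_left _ _)).trans ?_
    refine mul_le_mul_of_nonneg_right (mul_le_mul_of_nonneg_left (add_le_add ?_ ?_)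
      (cauchyConst_pos _).le) (Real.rpow_nonneg hx.le _)
    · rcases min_choice (1 / 2) √M with h | h <;> rw [h]
      · linarith
      · rw [Real.div_sqrt]; linarith
    · exact mul_le_mul_of_nonneg_left (min_le_right _ _) hA1
  have hσabs : ∀ {b C : ℝ}, |b| ≤ C → |σ * b| ≤ C := fun {b C} hb => by
    rw [abs_mul, abs_of_nonneg hσ]
    exact (mul_le_of_le_one_left (abs_nonneg _) hσ1.le).trans hb
  have hzero : ∀ x Y : ℝ, 1 ≤ x → 0 < Y → ∀ c : ℂ, ‖c‖ ≤ 1 →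
      |slice c 0 F x Y| ≤ smallConst A M * x ^ (-(1 / 2) : ℝ) := by
    intro x Y hx hY c hc
    have hx0 : 0 < x := by linarith
    exact (abs_slice_le hc x Y).trans ((hbase x Y hx0 hY).trans
      (mul_le_mul_of_nonneg_right hle (Real.rpow_nonneg hx0.le _)))
  have hone : ∀ x Y : ℝ, 1 ≤ x → 0 < Y →
      |slice (Real.pi⁻¹ : ℝ) 1 F x Y| ≤ smallConst A M * x ^ (-(3 / 2) : ℝ) := by
    intro x Y hx hY
    have hx0 : 0 < x := by linarith
    have hmono : ∀ b : ℝ, 0 ≤ b → ∀ y ∈ Ici x, y ^ (-b) ≤ x ^ (-b) := fun b hb y hy =>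
      Real.rpow_le_rpow_of_nonpos hx0 hy (by linarith)
    have hL := abs_deriv_le_of_abs_le (x := x) (h := √Θ * x)
      (f := fun s => slice (Real.pi⁻¹ : ℝ) 0 F s Y) (f' := fun s => slice (Real.pi⁻¹ : ℝ) 1 F s Y)
      (f'' := fun s => slice (Real.pi⁻¹ : ℝ) 2 F s Y)
      (P := Θ * x ^ (-(1 / 2) : ℝ)) (Q := decayConst (1 / 2) A 2 * x ^ (-(5 / 2) : ℝ))
      (fun y _ => (hasDerivAt_slice_fst ha hF hA y hY).hasDerivWithinAt)
      (fun y _ => (hasDerivAt_slice_fst ha hF hA y hY).hasDerivWithinAt)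
      (fun y hy => ?_) (fun y hy => ?_) (mul_pos hΘs hx0)
    · refine hL.trans ((le_of_eq ?_).trans
        (mul_le_mul_of_nonneg_right hle' (Real.rpow_nonneg hx0.le _)))
      have e1 : x ^ (-(1 / 2) : ℝ) = x ^ (-(3 / 2) : ℝ) * x := by
        rw [← Real.rpow_add_one hx0.ne']; norm_num
      have e2 : x ^ (-(3 / 2) : ℝ) = x ^ (-(5 / 2) : ℝ) * x := by
        rw [← Real.rpow_add_one hx0.ne']; norm_num
      have e3 : Θ / √Θ = √Θ := Real.div_sqrt
      rw [e1, show 2 * (Θ * (x ^ (-(3 / 2) : ℝ) * x)) / (√Θ * x) =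
        2 * (Θ / √Θ) * x ^ (-(3 / 2) : ℝ) by field_simp, e3,
        show decayConst (1 / 2) A 2 * x ^ (-(5 / 2) : ℝ) * (√Θ * x) =
        decayConst (1 / 2) A 2 * √Θ * (x ^ (-(5 / 2) : ℝ) * x) by ring, ← e2]
      ring
    · have hy0 : 0 < y := hx0.trans_le hy
      exact (abs_slice_le c1 y Y).trans ((hbase y Y hy0 hY).trans
        (mul_le_mul_of_nonneg_left (hmono _ (by norm_num) y hy) hΘ0.le))
    · have hy0 : 0 < y := hx0.trans_le hy
      have := norm_cauchy_iteratedDeriv_le ha ha1 hF hA 2 hy0 hY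
      rw [show -((2 : ℕ) : ℝ) - 1 / 2 = -(5 / 2) by norm_num] at this
      exact (abs_slice_le c1 y Y).trans (this.trans
        (mul_le_mul_of_nonneg_left (hmono _ (by norm_num) y hy) hD))
  refine ⟨fun x Y hx hY => ?_, fun x Y hx hY => ?_⟩
  · have h1 := hzero x Y hx hY _ c1
    have h2 := hzero x Y hx hY _ c2
    rw [← hu x Y hY] at h1
    rw [← hv x Y hY] at h2
    exact ⟨h1, h2, hσabs h1, hσabs h2⟩
  · have h1 := hone x Y hx hY
    have h2 : |dx (tangential (poisson F)) x Y| ≤ smallConst A M * x ^ (-(3 / 2) : ℝ) := by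
      rwa [dx_eq_slice ha hF hA hu x Y hY]
    have h3 : |dY (poisson F) x Y| ≤ smallConst A M * x ^ (-(3 / 2) : ℝ) := by
      rwa [dY_poisson_eq ha hF hA x Y hY, abs_neg]
    simp only [corrector, dx_const_mul, dY_const_mul]
    exact ⟨h2, h3, hσabs h2, hσabs h3⟩

theorem lossExp_mem {n i : ℕ} (hi : 2 ≤ i) (hin : i ≤ n) :
    0 < 3 / 4 - lossExp n (i - 1) ∧ 3 / 4 - lossExp n (i - 1) < 1 := by
  have h3 : (0 : ℝ) < 3 ^ n := by positivity
  have h0 : 0 < lossExp n (i - 1) := by unfold lossExp; positivity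
  have h1 : lossExp n (i - 1) ≤ 1 / 1000 := by
    unfold lossExp
    rw [div_le_div_iff₀ (by positivity) (by norm_num)]
    have : (3 : ℝ) ^ (i - 1) ≤ 3 ^ n := pow_le_pow_right₀ (by norm_num) (by omega)
    linarith
  constructor <;> linarith

theorem DecayBounds.mono {a : ℝ} {K K' : ℕ → ℕ → ℝ} {e : Fields} (h : DecayBounds a K e)
    (hK : ∀ k j, K k j ≤ K' k j) : DecayBounds a K' e := by
  have key : ∀ {b x c : ℝ} {k j : ℕ}, 1 ≤ x → b ≤ K k j * x ^ c → b ≤ K' k j * x ^ c :=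
    fun {b x c k j} hx hb => hb.trans (mul_le_mul_of_nonneg_right (hK k j)
      (Real.rpow_nonneg (by linarith) _))
  refine ⟨fun k j x Y hx hY => ?_, fun k x Y hk hx hY => ?_⟩
  · obtain ⟨h1, h2, h3, h4⟩ := h.derivatives k j x Y hx hY
    exact ⟨key hx h1, key hx h2, key hx h3, key hx h4⟩
  · obtain ⟨h1, h2⟩ := h.weighted k x Y hk hx hY
    exact ⟨key hx h1, key hx h2⟩

theorem exists_corrector_order_one (A : ℕ → ℝ) (Ω : ℝ → ℝ → ℝ) (hΩ : IsO Ω) :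
    ∃ (K : ℕ → ℕ → ℝ) (Θ : ℝ → ℝ → ℝ), IsO Θ ∧
      ∀ (δ σ : ℝ) (vp : ℕ → ℝ → ℝ → ℝ) (F : ℝ → ℝ), 0 < δ → δ < 1 → 0 ≤ σ → σ < 1 →
        IsWallExtension (1 / 2) A (fun x => -vp 0 x 0) F →
        (∀ x : ℝ, |F x| ≤ Ω δ σ * (1 + |x|) ^ (-(1 / 2) : ℝ)) →
        Solves σ (vp 0) (corrector σ F) ∧ SmallBounds (Θ δ σ) (corrector σ F) ∧
          DecayBounds (1 / 2) K (corrector σ F) := by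
  refine ⟨fun k j => decayConst (1 / 2) A (j + k), fun δ σ => smallConst A (|Ω δ σ| + δ),
    isO_comp_abs_add (tendsto_smallConst A) hΩ, fun δ σ vp F hδ _ hσ hσ1 hF hb => ?_⟩
  have ha : (0 : ℝ) < 1 / 2 := by norm_num
  have ha1 : (1 / 2 : ℝ) < 1 := by norm_num
  refine ⟨solves_corrector ha ha1 hF, smallBounds_corrector hσ hσ1 (by positivity) hF
    fun x => (hb x).trans (mul_le_mul_of_nonneg_right ?_ (by positivity)),
    decayBounds_corrector ha ha1 hσ hσ1 hF⟩
  linarith [le_abs_self (Ω δ σ)]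

theorem exists_corrector_higher_order (n : ℕ) (A : ℕ → ℝ) : ∃ K : ℕ → ℕ → ℝ,
    ∀ (i : ℕ) (σ : ℝ) (vp : ℕ → ℝ → ℝ → ℝ) (F : ℝ → ℝ), 2 ≤ i → i ≤ n → 0 ≤ σ → σ < 1 →
      IsWallExtension (3 / 4 - lossExp n (i - 1)) A (fun x => -vp (i - 1) x 0) F →
      Solves σ (vp (i - 1)) (corrector σ F) ∧
        DecayBounds (3 / 4 - lossExp n (i - 1)) K (corrector σ F) := by
  refine ⟨fun k j => ∑ i ∈ Finset.range (n + 1),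
    |decayConst (3 / 4 - lossExp n (i - 1)) A (j + k)|,
    fun i σ vp F hi hin hσ hσ1 hF => ?_⟩
  obtain ⟨ha, ha1⟩ := lossExp_mem hi hin
  refine ⟨solves_corrector ha ha1 hF, (decayBounds_corrector ha ha1 hσ hσ1 hF).mono
    fun k j => (le_abs_self _).trans ?_⟩
  exact Finset.single_le_sum
    (f := fun i => |decayConst (3 / 4 - lossExp n (i - 1)) A (j + k)|)
    (fun _ _ => abs_nonneg _) (Finset.mem_range.2 (by omega))

theorem iteratedDeriv_of_hasDerivAt {G : ℕ → ℝ → ℝ}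
    (h : ∀ n x, HasDerivAt (G n) (G (n + 1) x) x) (n : ℕ) : iteratedDeriv n (G 0) = G n := by
  induction n with
  | zero => exact iteratedDeriv_zero
  | succ n ih => rw [iteratedDeriv_succ, ih]; exact funext fun x => (h n x).deriv

theorem contDiff_of_hasDerivAt {G : ℕ → ℝ → ℝ}
    (h : ∀ n x, HasDerivAt (G n) (G (n + 1) x) x) : ContDiff ℝ ∞ (G 0) :=
  contDiff_of_differentiable_iteratedDeriv fun m _ => by
    rw [iteratedDeriv_of_hasDerivAt h m]
    exact fun x => (h m x).differentiableAt

/-- A smooth cutoff that is `1` near the origin and vanishes outside the unit interval. -/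
noncomputable def cutoff : ContDiffBump (0 : ℝ) := ⟨1 / 2, 1, by norm_num, by norm_num⟩

/-- A monomial, cut off to a neighbourhood of the origin. -/
noncomputable def bumpMonomial (k : ℕ) (y : ℝ) : ℝ := y ^ k * cutoff y

theorem contDiff_bumpMonomial (k : ℕ) : ContDiff ℝ ∞ (bumpMonomial k) :=
  (contDiff_id.pow k).mul cutoff.contDiff

theorem bumpMonomial_eq_zero (k : ℕ) {y : ℝ} (hy : 1 < |y|) : bumpMonomial k y = 0 := by
  have : cutoff y = 0 := cutoff.zero_of_le_dist (by rw [Real.dist_0_eq_abs]; exact hy.le)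
  rw [bumpMonomial, this, mul_zero]

theorem iteratedDeriv_bumpMonomial_zero (k n : ℕ) :
    iteratedDeriv n (bumpMonomial k) 0 = if n = k then (k.factorial : ℝ) else 0 := by
  have h : bumpMonomial k =ᶠ[𝓝 0] fun y => y ^ k := by
    filter_upwards [cutoff.eventuallyEq_one] with y hy
    rw [bumpMonomial, hy]; simp
  rw [h.iteratedDeriv_eq n, iteratedDeriv_fun_pow_zero]
  split_ifs <;> simp

theorem exists_bound_iteratedDeriv_bumpMonomial (k n : ℕ) :
    ∃ C, 0 ≤ C ∧ ∀ y, |iteratedDeriv n (bumpMonomial k) y| ≤ C := by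
  have hc : Continuous (iteratedDeriv n (bumpMonomial k)) :=
    (contDiff_bumpMonomial k).continuous_iteratedDeriv n (by exact_mod_cast le_top)
  obtain ⟨C, hC⟩ := (isCompact_Icc (a := (-1 : ℝ)) (b := 1)).exists_bound_of_continuousOn
    hc.continuousOn
  have hC0 : 0 ≤ C := (norm_nonneg _).trans (hC 0 (by simp))
  refine ⟨C, hC0, fun y => ?_⟩
  by_cases hy : |y| ≤ 1
  · exact hC y (abs_le.1 hy)
  · have h : bumpMonomial k =ᶠ[𝓝 y] fun _ => 0 := by
      filter_upwards [(isOpen_lt continuous_const continuous_abs).mem_nhds (not_le.1 hy)] with s hs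
      exact bumpMonomial_eq_zero k hs
    rw [h.iteratedDeriv_eq n]
    simpa [iteratedDeriv_const] using hC0

/-- Borel's lemma at the point `1`, with bounds that depend only on bounds for the jet. -/
theorem exists_contDiff_iteratedDeriv_eq (B : ℕ → ℝ) (hB : ∀ k, 0 ≤ B k) :
    ∃ D c : ℕ → ℝ, (∀ k, 0 ≤ c k) ∧ Summable (fun k => B k * c k) ∧
      ∀ β : ℕ → ℝ, (∀ k, |β k| ≤ B k) → ∃ P : ℝ → ℝ, ContDiff ℝ ∞ P ∧
        (∀ n, iteratedDeriv n P 1 = β n) ∧ (∀ n x, |iteratedDeriv n P x| ≤ D n) ∧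
        (∀ x < 0, P x = 0) ∧ ∀ x, |P x| ≤ ∑' k, |β k| * c k := by
  choose M hM0 hM using exists_bound_iteratedDeriv_bumpMonomial
  set l : ℕ → ℝ := fun k => 1 + 2 ^ k * B k * ∑ n ∈ Finset.range k, M k n with hl
  have hS : ∀ k, 0 ≤ ∑ n ∈ Finset.range k, M k n := fun k => Finset.sum_nonneg fun n _ => hM0 k n
  have hl1 : ∀ k, 1 ≤ l k := fun k => by
    have := mul_nonneg (mul_nonneg (pow_nonneg zero_le_two k) (hB k)) (hS k)
    simp only [hl]; linarith
  have hl0 : ∀ k, 0 < l k := fun k => one_pos.trans_le (hl1 k)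
  set c : ℕ → ℕ → ℝ := fun n k => l k ^ n / (k.factorial * l k ^ k) * M k n with hc
  have hcf : ∀ n k, 0 ≤ l k ^ n / (k.factorial * l k ^ k) := fun n k => by
    have := hl0 k; positivity
  have hc0 : ∀ n k, 0 ≤ c n k := fun n k => mul_nonneg (hcf n k) (hM0 k n)
  have hsum : ∀ n, Summable fun k => B k * c n k := by
    intro n
    refine Summable.of_norm_bounded_eventually_nat summable_geometric_two ?_
    filter_upwards [eventually_gt_atTop n] with k hk
    rw [Real.norm_of_nonneg (mul_nonneg (hB k) (hc0 n k))]
    have hlk := hl0 k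
    have h1 : l k ^ n / (k.factorial * l k ^ k) ≤ (l k)⁻¹ := by
      rw [div_le_iff₀ (by positivity)]
      have hf : (1 : ℝ) ≤ k.factorial := by exact_mod_cast Nat.one_le_iff_ne_zero.2 k.factorial_ne_zero
      have hp : l k ^ (n + 1) ≤ l k ^ k := pow_le_pow_right₀ (hl1 k) hk
      rw [← div_eq_inv_mul, le_div_iff₀ hlk, ← pow_succ]
      exact hp.trans (le_mul_of_one_le_left (by positivity) hf)
    have h2 : M k n ≤ ∑ n ∈ Finset.range k, M k n :=
      Finset.single_le_sum (f := fun n => M k n) (fun n _ => hM0 k n) (Finset.mem_range.2 hk)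
    have h3 : B k * M k n ≤ (1 / 2) ^ k * l k := by
      have h4 : B k * M k n ≤ B k * ∑ n ∈ Finset.range k, M k n :=
        mul_le_mul_of_nonneg_left h2 (hB k)
      have h5 : (1 / 2 : ℝ) ^ k * l k =
          (1 / 2) ^ k + (1 / 2 * 2) ^ k * (B k * ∑ n ∈ Finset.range k, M k n) := by
        simp only [hl]; rw [mul_pow]; ring
      have h6 : (0 : ℝ) ≤ (1 / 2) ^ k := by positivity
      rw [h5, one_div_mul_cancel two_ne_zero, one_pow, one_mul]
      linarith
    calc B k * c n k = l k ^ n / (k.factorial * l k ^ k) * (B k * M k n) := by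
          simp only [hc]; ring
      _ ≤ (l k)⁻¹ * ((1 / 2) ^ k * l k) :=
          mul_le_mul h1 h3 (mul_nonneg (hB k) (hM0 k n)) (by positivity)
      _ = (1 / 2) ^ k := by field_simp
  refine ⟨fun n => ∑' k, B k * c n k, c 0, hc0 0, hsum 0, fun β hβ => ?_⟩
  set p : ℕ → ℕ → ℝ → ℝ := fun n k x => β k * (l k ^ n / (k.factorial * l k ^ k) *
    iteratedDeriv n (bumpMonomial k) (l k * (x - 1))) with hp
  have hpb' : ∀ n k x, ‖p n k x‖ ≤ |β k| * c n k := fun n k x => by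
    simp only [hp, hc]
    rw [norm_mul, norm_mul, Real.norm_of_nonneg (hcf n k)]
    exact mul_le_mul_of_nonneg_left (mul_le_mul_of_nonneg_left (hM k n _) (hcf n k))
      (abs_nonneg _)
  have hpb : ∀ n k x, ‖p n k x‖ ≤ B k * c n k := fun n k x =>
    (hpb' n k x).trans (mul_le_mul_of_nonneg_right (hβ k) (hc0 n k))
  have hpd : ∀ n k x, HasDerivAt (p n k) (p (n + 1) k x) x := by
    intro n k x
    have h1 : HasDerivAt (fun x => l k * (x - 1)) (l k) x := by
      simpa using ((hasDerivAt_id x).sub_const 1).const_mul (l k)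
    have h2 := ((hasDerivAt_iteratedDeriv (contDiff_bumpMonomial k) n (l k * (x - 1))).comp x
      h1).const_mul (l k ^ n / (k.factorial * l k ^ k)) |>.const_mul (β k)
    refine h2.congr_deriv ?_
    simp only [hp]
    ring
  have hps : ∀ n x, Summable fun k => p n k x := fun n x =>
    Summable.of_norm_bounded (hsum n) (hpb n · x)
  have hG : ∀ n x, HasDerivAt (fun x => ∑' k, p n k x) (∑' k, p (n + 1) k x) x := fun n x =>
    hasDerivAt_tsum (hsum (n + 1)) (hpd n) (hpb (n + 1)) (hps n 1) x
  have hGi := fun n => iteratedDeriv_of_hasDerivAt (G := fun n x => ∑' k, p n k x) hG n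
  refine ⟨fun x => ∑' k, p 0 k x, contDiff_of_hasDerivAt (G := fun n x => ∑' k, p n k x) hG,
    fun n => ?_, fun n x => ?_, fun x hx => ?_, fun x => ?_⟩
  · rw [hGi n]
    have : ∀ k, p n k 1 = if k = n then β n else 0 := fun k => by
      simp only [hp, sub_self, mul_zero, iteratedDeriv_bumpMonomial_zero]
      by_cases h : n = k
      · subst h
        have := (hl0 n).ne'
        have : (n.factorial : ℝ) ≠ 0 := by exact_mod_cast n.factorial_ne_zero
        simp only [if_true]
        field_simp
      · rw [if_neg h, if_neg (Ne.symm h)]; simp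
    simp only [this, tsum_ite_eq]
  · rw [hGi n]
    exact tsum_of_norm_bounded (hsum n).hasSum (hpb n · x)
  · have : ∀ k, p 0 k x = 0 := fun k => by
      simp only [hp, iteratedDeriv_zero]
      rw [bumpMonomial_eq_zero k, mul_zero, mul_zero]
      rw [abs_mul, abs_of_pos (hl0 k), abs_of_neg (by linarith)]
      nlinarith [hl1 k]
    simp only [this, tsum_zero]
  · have hs : Summable fun k => |β k| * c 0 k :=
      (hsum 0).of_nonneg_of_le (fun k => mul_nonneg (abs_nonneg _) (hc0 0 k))
        fun k => mul_le_mul_of_nonneg_right (hβ k) (hc0 0 k)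
    exact tsum_of_norm_bounded hs.hasSum (hpb' 0 · x)

theorem hasDerivWithinAt_iteratedDerivWithin {f : ℝ → ℝ} (hf : ContDiffOn ℝ ∞ f (Ici 1)) (n : ℕ)
    {x : ℝ} (hx : 1 ≤ x) :
    HasDerivWithinAt (iteratedDerivWithin n f (Ici 1)) (iteratedDerivWithin (n + 1) f (Ici 1) x)
      (Ici 1) x := by
  rw [iteratedDerivWithin_succ]
  exact (hf.differentiableOn_iteratedDerivWithin (by exact_mod_cast WithTop.coe_lt_top _)
    (uniqueDiffOn_Ici 1) x hx).hasDerivWithinAt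

/-- Functions with the same jet at `1` can be glued smoothly there. -/
theorem hasDerivAt_glue {f P : ℝ → ℝ} (hf : ContDiffOn ℝ ∞ f (Ici 1)) (hP : ContDiff ℝ ∞ P)
    (h : ∀ n, iteratedDeriv n P 1 = iteratedDerivWithin n f (Ici 1) 1) (n : ℕ) (x : ℝ) :
    HasDerivAt (fun x => if 1 ≤ x then iteratedDerivWithin n f (Ici 1) x else iteratedDeriv n P x)
      (if 1 ≤ x then iteratedDerivWithin (n + 1) f (Ici 1) x else iteratedDeriv (n + 1) P x) x := by
  rcases lt_trichotomy x 1 with hx | rfl | hx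
  · rw [if_neg (not_le.2 hx)]
    refine (hasDerivAt_iteratedDeriv hP n x).congr_of_eventuallyEq ?_
    filter_upwards [Iio_mem_nhds hx] with s hs
    exact if_neg (not_le.2 hs)
  · rw [if_pos le_rfl, ← hasDerivWithinAt_univ, ← Iic_union_Ici (a := (1 : ℝ))]
    refine HasDerivWithinAt.union ?_ ?_
    · rw [← h]
      refine (hasDerivAt_iteratedDeriv hP n 1).hasDerivWithinAt.congr (fun s hs => ?_) ?_
      · rcases (show s ≤ 1 from hs).eq_or_lt with rfl | hs
        · rw [if_pos le_rfl, h]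
        · exact if_neg (not_le.2 hs)
      · rw [if_pos le_rfl, h]
    · exact (hasDerivWithinAt_iteratedDerivWithin hf n le_rfl).congr (fun s hs => if_pos hs)
        (if_pos le_rfl)
  · rw [if_pos hx.le]
    refine ((hasDerivWithinAt_iteratedDerivWithin hf n hx.le).hasDerivAt
      (Ici_mem_nhds hx)).congr_of_eventuallyEq ?_
    filter_upwards [Ioi_mem_nhds hx] with s hs
    exact if_pos (le_of_lt hs)

/-- Iterated interpolation bounds for the derivatives of a function of size `M`. -/
noncomputable def interpBound (B : ℕ → ℝ) (M : ℝ) : ℕ → ℝ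
  | 0 => |M|
  | k + 1 => (2 + B (k + 2)) * √(interpBound B M k)

theorem interpBound_pos {B : ℕ → ℝ} (hB : ∀ k, 0 ≤ B k) {M : ℝ} (hM : 0 < M) (k : ℕ) :
    0 < interpBound B M k := by
  induction k with
  | zero => exact abs_pos.2 hM.ne'
  | succ k ih => exact mul_pos (by linarith [hB (k + 2)]) (Real.sqrt_pos.2 ih)

theorem interpBound_nonneg {B : ℕ → ℝ} (hB : ∀ k, 0 ≤ B k) (M : ℝ) (k : ℕ) :
    0 ≤ interpBound B M k := by
  cases k with
  | zero => exact abs_nonneg M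
  | succ k => exact mul_nonneg (by linarith [hB (k + 2)]) (Real.sqrt_nonneg _)

theorem tendsto_interpBound (B : ℕ → ℝ) (k : ℕ) :
    Tendsto (fun M => interpBound B M k) (𝓝 0) (𝓝 0) := by
  induction k with
  | zero => simpa [interpBound] using (continuous_abs.tendsto (0 : ℝ))
  | succ k ih =>
    have := (((Real.continuous_sqrt.tendsto 0).comp ih).const_mul (2 + B (k + 2)))
    simpa [interpBound, Function.comp_def] using this

theorem abs_iteratedDerivWithin_le_interpBound {B : ℕ → ℝ} (hB : ∀ k, 0 ≤ B k) {f : ℝ → ℝ}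
    (hf : ContDiffOn ℝ ∞ f (Ici 1))
    (hfB : ∀ k x, 1 ≤ x → |iteratedDerivWithin k f (Ici 1) x| ≤ B k) {M : ℝ} (hM : 0 < M)
    (hfM : ∀ x, 1 ≤ x → |f x| ≤ M) (k : ℕ) {x : ℝ} (hx : 1 ≤ x) :
    |iteratedDerivWithin k f (Ici 1) x| ≤ interpBound B M k := by
  induction k generalizing x with
  | zero =>
    rw [iteratedDerivWithin_zero]
    exact (hfM x hx).trans (le_abs_self M)
  | succ k ih =>
    have hsub : Ici x ⊆ Ici 1 := Ici_subset_Ici.2 hx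
    have hb := Real.sqrt_pos.2 (interpBound_pos hB hM k)
    have := abs_deriv_le_of_abs_le (x := x)
      (fun y hy => (hasDerivWithinAt_iteratedDerivWithin hf k (hsub hy)).mono hsub)
      (fun y hy => (hasDerivWithinAt_iteratedDerivWithin hf (k + 1) (hsub hy)).mono hsub)
      (fun y hy => ih (hsub hy)) (fun y hy => hfB (k + 2) y (hsub hy)) hb
    refine this.trans_eq ?_
    rw [interpBound, mul_div_assoc, Real.div_sqrt]
    ring

theorem rpow_le_two_rpow_mul {s x : ℝ} (hs : 0 ≤ s) (hx : 1 ≤ x) :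
    x ^ (-s) ≤ 2 ^ s * (1 + |x|) ^ (-s) := by
  have hx0 : 0 < x := by linarith
  rw [abs_of_pos hx0]
  calc x ^ (-s) ≤ ((1 + x) / 2) ^ (-s) :=
        Real.rpow_le_rpow_of_nonpos (by linarith) (by linarith) (by linarith)
    _ = 2 ^ s * (1 + x) ^ (-s) := by
        rw [Real.div_rpow (by linarith) zero_le_two, Real.rpow_neg zero_le_two, div_inv_eq_mul,
          mul_comm]

theorem one_le_two_rpow_mul {s x : ℝ} (hs : 0 ≤ s) (hx : |x| ≤ 1) :
    1 ≤ (2 : ℝ) ^ s * (1 + |x|) ^ (-s) := by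
  have h1 : (2 : ℝ) ^ (-s) ≤ (1 + |x|) ^ (-s) :=
    Real.rpow_le_rpow_of_nonpos (by positivity) (by linarith) (by linarith)
  calc (1 : ℝ) = 2 ^ s * 2 ^ (-s) := by rw [← Real.rpow_add two_pos, add_neg_cancel, Real.rpow_zero]
    _ ≤ _ := by gcongr

/-- Extension of wall data to the line, quantitative in the decay constants and in the size. -/
theorem exists_isWallExtension {a : ℝ} (ha : 0 < a) (B : ℕ → ℝ) :
    ∃ (A : ℕ → ℝ) (φ : ℝ → ℝ), Tendsto φ (𝓝 0) (𝓝 0) ∧ ∀ f : ℝ → ℝ, WallDecay a B f →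
      ∃ F : ℝ → ℝ, IsWallExtension a A f F ∧
        ∀ M, 0 < M → (∀ x, 1 ≤ x → |f x| ≤ M * x ^ (-a)) →
          ∀ x, |F x| ≤ φ M * (1 + |x|) ^ (-a) := by
  obtain ⟨D, c, hc0, hsum, hborel⟩ :=
    exists_contDiff_iteratedDeriv_eq (fun k => |B k|) fun k => abs_nonneg _
  set B' : ℕ → ℝ := fun k => |B k| with hB'
  have hB0 : ∀ k, 0 ≤ B' k := fun k => abs_nonneg _
  set S : ℝ → ℝ := fun M => ∑' k, min (interpBound B' M k) (B' k) * c k with hS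
  have hmin0 : ∀ M k, 0 ≤ min (interpBound B' M k) (B' k) := fun M k =>
    le_min (interpBound_nonneg hB0 M k) (hB0 k)
  have hSt : Tendsto S (𝓝 0) (𝓝 0) := by
    have := tendsto_tsum_of_dominated_convergence (𝓕 := 𝓝 (0 : ℝ))
      (f := fun M k => min (interpBound B' M k) (B' k) * c k) (g := fun _ => (0 : ℝ)) hsum
      (fun k => ?_) (Eventually.of_forall fun M k => ?_)
    · simpa using this
    · have := ((tendsto_interpBound B' k).min (tendsto_const_nhds (x := B' k))).mul_const (c k)
      rwa [min_eq_left (hB0 k), zero_mul] at this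
    · rw [Real.norm_of_nonneg (mul_nonneg (hmin0 M k) (hc0 k))]
      exact mul_le_mul_of_nonneg_right (min_le_right _ _) (hc0 k)
  refine ⟨fun k => (B' k + D k) * 2 ^ ((k : ℝ) + a), fun M => (M + S M) * 2 ^ a, ?_,
    fun f hf => ?_⟩
  · simpa using ((tendsto_id (x := 𝓝 (0 : ℝ))).add hSt).mul_const ((2 : ℝ) ^ a)
  obtain ⟨hfs, hfB⟩ := hf
  have hfB1 : ∀ k x, 1 ≤ x → |iteratedDerivWithin k f (Ici 1) x| ≤ B' k * x ^ (-((k : ℝ) + a)) :=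
    fun k x hx => by
      rw [neg_add']
      exact (hfB k x hx).trans (mul_le_mul_of_nonneg_right (le_abs_self _) (by positivity))
  have hfB2 : ∀ k x, 1 ≤ x → |iteratedDerivWithin k f (Ici 1) x| ≤ B' k := fun k x hx =>
    (hfB1 k x hx).trans (mul_le_of_le_one_right (hB0 k)
      (Real.rpow_le_one_of_one_le_of_nonpos hx (by linarith [Nat.cast_nonneg (α := ℝ) k])))
  obtain ⟨P, hP, hjet, hPD, hPz, hPb⟩ := hborel (fun k => iteratedDerivWithin k f (Ici 1) 1)
    fun k => hfB2 k 1 le_rfl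
  have hD0 : ∀ k, 0 ≤ D k := fun k => (abs_nonneg _).trans (hPD k 0)
  set G : ℕ → ℝ → ℝ := fun n x =>
    if 1 ≤ x then iteratedDerivWithin n f (Ici 1) x else iteratedDeriv n P x with hG
  have hGd : ∀ n x, HasDerivAt (G n) (G (n + 1) x) x := hasDerivAt_glue hfs hP hjet
  have hPz' : ∀ k, ∀ x < 0, iteratedDeriv k P x = 0 := fun k x hx => by
    have h : P =ᶠ[𝓝 x] fun _ => 0 := by
      filter_upwards [Iio_mem_nhds hx] with s hs using hPz s hs
    rw [h.iteratedDeriv_eq k, iteratedDeriv_const]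
    simp
  have hglue : ∀ (k : ℕ) (s C E : ℝ), 0 ≤ s → 0 ≤ C → 0 ≤ E →
      (∀ x, 1 ≤ x → |iteratedDerivWithin k f (Ici 1) x| ≤ C * x ^ (-s)) →
      (∀ x, |iteratedDeriv k P x| ≤ E) → ∀ x, |G k x| ≤ (C + E) * 2 ^ s * (1 + |x|) ^ (-s) := by
    intro k s C E hs hC hE h1 h2 x
    rw [mul_assoc]
    have hp : 0 ≤ (2 : ℝ) ^ s * (1 + |x|) ^ (-s) := by positivity
    simp only [hG]
    split_ifs with hx
    · refine (h1 x hx).trans ((mul_le_mul_of_nonneg_left (rpow_le_two_rpow_mul hs hx) hC).trans ?_)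
      exact mul_le_mul_of_nonneg_right (by linarith) hp
    · rcases lt_or_ge x 0 with hx0 | hx0
      · rw [hPz' k x hx0, abs_zero]; positivity
      · have hx1 : |x| ≤ 1 := by rw [abs_of_nonneg hx0]; linarith
        refine (h2 x).trans ((le_mul_of_one_le_right hE (one_le_two_rpow_mul hs hx1)).trans ?_)
        exact mul_le_mul_of_nonneg_right (by linarith) hp
  refine ⟨G 0, ⟨fun x hx => ?_, contDiff_of_hasDerivAt hGd, fun k x => ?_⟩, fun M hM hfM x => ?_⟩
  · simp only [hG]
    rw [if_pos hx, iteratedDerivWithin_zero]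
  · rw [iteratedDeriv_of_hasDerivAt hGd k, ← neg_add']
    exact hglue k _ _ _ (by positivity) (hB0 k) (hD0 k) (hfB1 k) (hPD k) x
  · have hfM' : ∀ x, 1 ≤ x → |f x| ≤ M := fun x hx =>
      (hfM x hx).trans (mul_le_of_le_one_right hM.le
        (Real.rpow_le_one_of_one_le_of_nonpos hx (by linarith)))
    have hle : ∀ k, |iteratedDerivWithin k f (Ici 1) 1| * c k ≤
        min (interpBound B' M k) (B' k) * c k := fun k =>
      mul_le_mul_of_nonneg_right (le_min
        (abs_iteratedDerivWithin_le_interpBound hB0 hfs hfB2 hM hfM' k le_rfl)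
        (hfB2 k 1 le_rfl)) (hc0 k)
    have hs2 : Summable fun k => min (interpBound B' M k) (B' k) * c k :=
      hsum.of_nonneg_of_le (fun k => mul_nonneg (hmin0 M k) (hc0 k))
        fun k => mul_le_mul_of_nonneg_right (min_le_right _ _) (hc0 k)
    have hs1 := hs2.of_nonneg_of_le (fun k => mul_nonneg (abs_nonneg _) (hc0 k)) hle
    refine hglue 0 a M (S M) ha.le hM.le
      (tsum_nonneg fun k => mul_nonneg (hmin0 M k) (hc0 k)) (by simpa using hfM) (fun x => ?_) x
    rw [iteratedDeriv_zero]
    exact (hPb x).trans (hs1.tsum_le_tsum hle hs2)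

theorem IsWallExtension.neg {a : ℝ} {A : ℕ → ℝ} {f F : ℝ → ℝ} (h : IsWallExtension a A f F) :
    IsWallExtension a A (fun x => -f x) (fun x => -F x) := by
  refine ⟨fun x hx => congrArg Neg.neg (h.1 x hx), h.2.1.neg, fun k x => ?_⟩
  rw [iteratedDeriv_fun_neg, abs_neg]
  exact h.2.2 k x

theorem IsWallExtension.mono {a : ℝ} {A A' : ℕ → ℝ} {f F : ℝ → ℝ} (h : IsWallExtension a A f F)
    (hA : ∀ k, A k ≤ A' k) : IsWallExtension a A' f F :=
  ⟨h.1, h.2.1, fun k x => (h.2.2 k x).trans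
    (mul_le_mul_of_nonneg_right (hA k) (by positivity))⟩

theorem exists_extension_order_one (B : ℕ → ℝ) (m : ℝ → ℝ → ℝ) (hm : IsO m) :
    ∃ (A : ℕ → ℝ) (Ω : ℝ → ℝ → ℝ), IsO Ω ∧
      ∀ (δ σ : ℝ) (vp : ℕ → ℝ → ℝ → ℝ), 0 < δ → δ < 1 → 0 ≤ σ → σ < 1 →
        WallDecay (1 / 2) B (fun x => vp 0 x 0) →
        (∀ x : ℝ, 1 ≤ x → |vp 0 x 0| ≤ m δ σ * x ^ (-(1 / 2) : ℝ)) →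
        ∃ F : ℝ → ℝ, IsWallExtension (1 / 2) A (fun x => -vp 0 x 0) F ∧
          ∀ x : ℝ, |F x| ≤ Ω δ σ * (1 + |x|) ^ (-(1 / 2) : ℝ) := by
  obtain ⟨A, φ, hφ, h⟩ := exists_isWallExtension (a := 1 / 2) one_half_pos B
  refine ⟨A, fun δ σ => φ (|m δ σ| + δ), isO_comp_abs_add hφ hm, fun δ σ vp hδ _ _ _ hB hb => ?_⟩
  obtain ⟨F, hF, hsmall⟩ := h _ hB
  refine ⟨fun x => -F x, hF.neg, fun x => ?_⟩
  rw [abs_neg]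
  refine hsmall _ (by positivity) (fun x hx => (hb x hx).trans ?_) x
  exact mul_le_mul_of_nonneg_right (by linarith [le_abs_self (m δ σ)])
    (Real.rpow_nonneg (by linarith) _)

theorem exists_extension_higher_order (n : ℕ) (B : ℕ → ℝ) : ∃ A : ℕ → ℝ,
    ∀ (i : ℕ) (vp : ℕ → ℝ → ℝ → ℝ), 2 ≤ i → i ≤ n →
      WallDecay (3 / 4 - lossExp n (i - 1)) B (fun x => vp (i - 1) x 0) →
      ∃ F : ℝ → ℝ, IsWallExtension (3 / 4 - lossExp n (i - 1)) A (fun x => -vp (i - 1) x 0) F := by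
  have key : ∀ i, ∃ A : ℕ → ℝ, 2 ≤ i → i ≤ n → ∀ f, WallDecay (3 / 4 - lossExp n (i - 1)) B f →
      ∃ F : ℝ → ℝ, IsWallExtension (3 / 4 - lossExp n (i - 1)) A f F := by
    intro i
    by_cases hi : 2 ≤ i ∧ i ≤ n
    · obtain ⟨A, φ, -, h⟩ := exists_isWallExtension (lossExp_mem hi.1 hi.2).1 B
      exact ⟨A, fun _ _ f hf => (h f hf).imp fun _ hF => hF.1⟩
    · exact ⟨0, fun h1 h2 => absurd ⟨h1, h2⟩ hi⟩
  choose A hA using key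
  refine ⟨fun k => ∑ i ∈ Finset.range (n + 1), |A i k|, fun i vp hi hin hB => ?_⟩
  obtain ⟨F, hF⟩ := hA i hi hin _ hB
  refine ⟨fun x => -F x, hF.neg.mono fun k => (le_abs_self _).trans ?_⟩
  exact Finset.single_le_sum (f := fun i => |A i k|) (fun _ _ => abs_nonneg _)
    (Finset.mem_range.2 (by omega))

end IdealMHD

theorem mainTheorem5 :
    -- order one: the wall datum has a smooth extension to the line, of the same decay and smallness
    (∀ (B : ℕ → ℝ) (m : ℝ → ℝ → ℝ), IdealMHD.IsO m →
      ∃ (A : ℕ → ℝ) (Ω : ℝ → ℝ → ℝ), IdealMHD.IsO Ω ∧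
        ∀ (δ σ : ℝ) (vp : ℕ → ℝ → ℝ → ℝ), 0 < δ → δ < 1 → 0 ≤ σ → σ < 1 →
          IdealMHD.WallDecay (1 / 2) B (fun x => vp 0 x 0) →
          (∀ x : ℝ, 1 ≤ x → |vp 0 x 0| ≤ m δ σ * x ^ (-(1 / 2) : ℝ)) →
          ∃ F : ℝ → ℝ, IdealMHD.IsWallExtension (1 / 2) A (fun x => -vp 0 x 0) F ∧
            ∀ x : ℝ, |F x| ≤ Ω δ σ * (1 + |x|) ^ (-(1 / 2) : ℝ)) ∧
    -- order one: every such extension generates a corrector with the stated properties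
    (∀ (A : ℕ → ℝ) (Ω : ℝ → ℝ → ℝ), IdealMHD.IsO Ω →
      ∃ (K : ℕ → ℕ → ℝ) (Θ : ℝ → ℝ → ℝ), IdealMHD.IsO Θ ∧
        ∀ (δ σ : ℝ) (vp : ℕ → ℝ → ℝ → ℝ) (F : ℝ → ℝ), 0 < δ → δ < 1 → 0 ≤ σ → σ < 1 →
          IdealMHD.IsWallExtension (1 / 2) A (fun x => -vp 0 x 0) F →
          (∀ x : ℝ, |F x| ≤ Ω δ σ * (1 + |x|) ^ (-(1 / 2) : ℝ)) →
          IdealMHD.Solves σ (vp 0) (IdealMHD.corrector σ F) ∧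
          IdealMHD.SmallBounds (Θ δ σ) (IdealMHD.corrector σ F) ∧
          IdealMHD.DecayBounds (1 / 2) K (IdealMHD.corrector σ F)) ∧
    -- orders two to n: extension of the wall datum
    (∀ (n : ℕ) (B : ℕ → ℝ), ∃ A : ℕ → ℝ,
      ∀ (i : ℕ) (vp : ℕ → ℝ → ℝ → ℝ), 2 ≤ i → i ≤ n →
        IdealMHD.WallDecay (3 / 4 - IdealMHD.lossExp n (i - 1)) B (fun x => vp (i - 1) x 0) →
        ∃ F : ℝ → ℝ, IdealMHD.IsWallExtension (3 / 4 - IdealMHD.lossExp n (i - 1)) A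
          (fun x => -vp (i - 1) x 0) F) ∧
    -- orders two to n: the correctors
    (∀ (n : ℕ) (A : ℕ → ℝ), ∃ K : ℕ → ℕ → ℝ,
      ∀ (i : ℕ) (σ : ℝ) (vp : ℕ → ℝ → ℝ → ℝ) (F : ℝ → ℝ), 2 ≤ i → i ≤ n → 0 ≤ σ → σ < 1 →
        IdealMHD.IsWallExtension (3 / 4 - IdealMHD.lossExp n (i - 1)) A
          (fun x => -vp (i - 1) x 0) F →
        IdealMHD.Solves σ (vp (i - 1)) (IdealMHD.corrector σ F) ∧
        IdealMHD.DecayBounds (3 / 4 - IdealMHD.lossExp n (i - 1)) K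
          (IdealMHD.corrector σ F)) :=
  ⟨IdealMHD.exists_extension_order_one, IdealMHD.exists_corrector_order_one,
    IdealMHD.exists_extension_higher_order, IdealMHD.exists_corrector_higher_order⟩
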